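/- Notation. For $c=\pm1$, $\alpha>0$ and an integer $s\ge 1$ (with $s\ne 1$ when $c=1$) let $\Phi(c,s,\alpha)=\sum_{k=0}^\infty \frac{c^k}{(k+\alpha)^s}$ be the Lerch transcendent, and put, by analytic continuation in $s$, $\Phi(1,0,1)=\zeta(0)=-\tfrac12$ and $\Phi(-1,0,1)=\eta(0)=\tfrac12$. For $0<s<r$ and an integer $q\ge1$ let $$\Theta(c,q,s,r)=\Phi\left(c,q,\tfrac sr\right)+c(-1)^q\,\Phi\left(c,q,\tfrac{r-s}{r}\right)\quad\text{if }(c,q)\ne(1,1),\qquad \Theta(1,1,s,r)=\pi\cot\left(\tfrac{\pi s}{r}\right).$$ For an integer $p\ge1$ and real $x$ (with $x\neq1$ if $p=1$) let $\operatorname{Li}_p(x)=\frac{(-1)^{p-1}}{(p-1)!}\int_0^1\frac{x\ln^{p-1}(y)}{1-xy}\,dy$, where for $x>1$ the integral is the Cauchy principal value at $y=1/x$. Theorem. Let $p,q,n$ be positive integers, $b=\pm1$ and $a=(-1)^{p+q-1}$, with $p\ne1$ when $a^nb=1$, and $q\neq 1$ when $a=1$. Then the following two integrals converge absolutely and have the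 stated values. (i) $$\int_0^1\frac{\ln^{q-1}(x)\operatorname{Li}_p(bx^{2n})}{1-ax^2}\,dx=-\tfrac12a^{n-1}b\,2^{-q}(q-1)!\,(1-(-1)^p)\,\Phi(a,q,\tfrac12)\,\Phi(a^nb,p,1)$$ $$+ab\,2^{-q}n^p(q-1)!\sum_{k=0}^{\lfloor p/2\rfloor}\binom{p+q-2k-1}{q-1}n^{-2k}\,\Phi(b,2k,1)\,\Phi(a,p+q-2k,\tfrac12)$$ $$+\tfrac12a^{n-1}b\,(2n)^{-q}(q-1)!\sum_{j=1}^n\sum_{k=1}^q\binom{p+q-k-1}{p-1}a^j(-1)^k\,\Theta(b,k,2j-1,2n)\,\Phi\left(a^nb,p+q-k,\tfrac{2n-2j+1}{2n}\right);$$ (ii) $$\int_0^1\frac{\ln^{q-1}(x)\operatorname{Li}_p(bx^{-2n})}{1-ax^2}\,dx=-\tfrac12a^{n}b\,(-2)^{-q}(q-1)!\,(1-(-1)^p)\,\Phi(a,q,\tfrac12)\,\Phi(a^nb,p,1)$$ $$-b\,(-2)^{-q}n^p(q-1)!\sum_{k=0}^{\lfloor p/2\rfloor}\binom{p+q-2k-1}{q-1}n^{-2k}\,\Phi(b,2k,1)\,\Phi(a,p+q-2k,\tfrac12)$$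 $$+\tfrac12a^{n}b\,(-2n)^{-q}(q-1)!\sum_{j=1}^n\sum_{k=1}^q\binom{p+q-k-1}{p-1}a^j(-1)^k\,\Theta(b,k,2j-1,2n)\,\Phi\left(a^nb,p+q-k,\tfrac{2n-2j+1}{2n}\right).$$ In part (ii), when $b=1$, the polylogarithm is taken at arguments $x^{-2n}>1$, and the Cauchy principal value that defines it exists for every $x\in(0,1)$. -/

import Mathlib

open MeasureTheory Filter Topology

namespace PolylogIntegral

noncomputable section

/-- The Lerch transcendent `Φ(c, s, α) = ∑_{k ≥ 0} c ^ k / (k + α) ^ s` for an integer order `s`.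
For `s ≥ 1` the sum is the limit of the partial sums `∑_{k < N}` (it converges only conditionally
when `c = -1` and `s = 1`).  For `s = 0` the value is the one at `0` of the analytic continuation
in `s`: this is the Hurwitz zeta value `ζ(0, α) = 1/2 - α` if `c = 1`, and `1 / (1 - c)` if
`c = -1`. -/
def lerchPhi (c : ℝ) (s : ℕ) (α : ℝ) : ℝ :=
  if s = 0 then (if c = 1 then 1 / 2 - α else 1 / (1 - c))
  else ∑'[SummationFilter.conditional ℕ] k : ℕ, c ^ k / ((k : ℝ) + α) ^ s

/-- `Φ(1, 0, 1)` is the value of the Riemann zeta function at `0`. -/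
theorem lerchPhi_one_zero_one : (lerchPhi 1 0 1 : ℂ) = riemannZeta 0 := by
  rw [riemannZeta_zero, lerchPhi]
  norm_num

/-- `Φ(-1, 0, 1)` is the value at `s = 0` of the Dirichlet eta function
`η(s) = (1 - 2 ^ (1 - s)) ζ(s)`. -/
theorem lerchPhi_neg_one_zero_one :
    (lerchPhi (-1) 0 1 : ℂ) = (1 - (2 : ℂ) ^ (1 - (0 : ℂ))) * riemannZeta 0 := by
  rw [riemannZeta_zero, lerchPhi]
  norm_num

/-- `Θ(c, q, s, r) = Φ(c, q, s/r) + c (-1)^q Φ(c, q, (r-s)/r)`.  In the case `c = q = 1`, where the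
two series diverge separately, `Θ(1, 1, s, r) = π cot(π s / r)`. -/
def lerchTheta (c : ℝ) (q : ℕ) (s r : ℝ) : ℝ :=
  if c = 1 ∧ q = 1 then Real.pi * Real.cot (Real.pi * s / r)
  else lerchPhi c q (s / r) + c * (-1) ^ q * lerchPhi c q ((r - s) / r)

/-- `v` is the Cauchy principal value of `∫ y in a..b, f y` at the singularity `c ∈ (a, b)`. -/
def HasPVIntegral (f : ℝ → ℝ) (a c b v : ℝ) : Prop :=
  (∀ᶠ ε in 𝓝[>] (0 : ℝ),
    IntervalIntegrable f volume a (c - ε) ∧ IntervalIntegrable f volume (c + ε) b) ∧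
  Tendsto (fun ε : ℝ => (∫ y in a..(c - ε), f y) + ∫ y in (c + ε)..b, f y) (𝓝[>] 0) (𝓝 v)

/-- The Cauchy principal value of `∫ y in a..b, f y` at the singularity `c ∈ (a, b)`. -/
def pvIntegral (f : ℝ → ℝ) (a c b : ℝ) : ℝ :=
  limUnder (𝓝[>] (0 : ℝ)) fun ε : ℝ => (∫ y in a..(c - ε), f y) + ∫ y in (c + ε)..b, f y

/-- The integrand `x ln^{p-1}(y) / (1 - x y)` of the integral that defines `Li_p(x)`. -/
def polylogIntegrand (p : ℕ) (x y : ℝ) : ℝ :=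
  x * Real.log y ^ (p - 1) / (1 - x * y)

/-- The real polylogarithm of integer order `p ≥ 1`,
`Li_p(x) = (-1)^{p-1} / (p-1)! * ∫_0^1 x ln^{p-1}(y) / (1 - x y) dy`,
where for `x > 1` the integral is the Cauchy principal value at `y = 1 / x`. -/
def polylog (p : ℕ) (x : ℝ) : ℝ :=
  (-1) ^ (p - 1) / ((p - 1).factorial : ℝ) *
    (if x ≤ 1 then ∫ y in (0 : ℝ)..1, polylogIntegrand p x y
      else pvIntegral (polylogIntegrand p x) 0 (1 / x) 1)

end

end PolylogIntegral

namespace PolylogIntegral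

/-! ### Convergence of the Lerch series -/

/-! Part (i) is the evaluation of a linear Euler sum. Expanding `polylog` in powers of its argument
and integrating termwise gives a constant times S = ∑_{m≥1} b^m m^{-p} Φ(a, q, nm + 1/2)
(`integral_log_mul_polylog_eq`). To find S, the double sum of a^l b^m / (m^p (nm + l + 1/2)^q) over
l ≥ 0 and 0 < |m| ≤ N is computed in two ways.

With l summed first, the row of -m begins with nm terms of negative base; reversed, they form a
partial sum of Φ(a, q, 1/2). Since a (-1)^{p+q} = -1, they contribute a second copy of the row of m
instead of cancelling it (`tendsto_sum_half_add_sub`). The result is 2S minus a product of two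
single series.

With m summed first, partial fractions (`one_div_pow_mul_pow`) leave zeta or eta values of even
order and symmetric sums ∑_{|m|≤N} b^m / (x + m)^k at x = (l + 1/2)/n. These tend to values of Θ
(`tendsto_symSum`), and in the limit x → x + 1 only multiplies them by b. Writing l = nt + j, what
remains is a sum over t, which is a value of Φ(a^n b, ·, ·).

The series converge only conditionally, so the exchange of the two limits is the analytic point. The
symmetric sums truncated at N vary in t by O(1/(|t - N| + 1)), and blocks of the Lerch series
starting at v are O(1/(v + 1)). Summation by parts then bounds the error by a multiple of ∑_v 1/((v
+ 1)(|v - N| + 1)), which tends to 0 with N uniformly in the cutoff of t (`iterLim_symSum`).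

Part (ii) follows from (i) by the inversion formula `polylog_inversion`, which expresses Li_p(b/X)
through Li_p(bX) and a polynomial in ln X. With X = x^{2n} the polynomial integrates to -2 times the
zeta/eta term already present, so that term changes its relative sign. -/

theorem hasSum_conditional_nat_iff {f : ℕ → ℝ} {L : ℝ} :
    HasSum f L (SummationFilter.conditional ℕ) ↔
      Tendsto (fun N => ∑ k ∈ Finset.range N, f k) atTop (𝓝 L) := by
  rw [HasSum, SummationFilter.conditional_filter_eq_map_range, tendsto_map'_iff]
  rfl

theorem lerchPhi_eq_of_tendsto {c α L : ℝ} {s : ℕ} (hs : 1 ≤ s)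
    (h : Tendsto (fun N => ∑ k ∈ Finset.range N, c ^ k / ((k : ℝ) + α) ^ s) atTop (𝓝 L)) :
    lerchPhi c s α = L := by
  rw [lerchPhi, if_neg (by omega)]
  exact (hasSum_conditional_nat_iff.2 h).tsum_eq

theorem tendsto_sum_lerchPhi {c α : ℝ} {s : ℕ} (hc : c = 1 ∨ c = -1) (hs : 1 ≤ s)
    (hcs : c = 1 → s ≠ 1) (hα : 0 < α) :
    Tendsto (fun N => ∑ k ∈ Finset.range N, c ^ k / ((k : ℝ) + α) ^ s) atTop
      (𝓝 (lerchPhi c s α)) := by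
  have key : ∃ L, Tendsto (fun N => ∑ k ∈ Finset.range N, c ^ k / ((k : ℝ) + α) ^ s) atTop
      (𝓝 L) := by
    rcases hc with rfl | rfl
    · have h2 : 2 ≤ s := by have := hcs rfl; omega
      have hsum : Summable fun k : ℕ => (1 : ℝ) ^ k / ((k : ℝ) + α) ^ s := by
        have := (Real.summable_one_div_nat_add_rpow α s).2 (by exact_mod_cast h2)
        refine this.congr fun k => ?_
        rw [abs_of_pos (by positivity), Real.rpow_natCast, one_pow]
      exact ⟨_, hsum.hasSum.tendsto_sum_nat⟩
    · have hanti : Antitone fun k : ℕ => 1 / ((k : ℝ) + α) ^ s := by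
        intro i j hij
        have : (i : ℝ) ≤ j := by exact_mod_cast hij
        dsimp only
        gcongr
      have h0 : Tendsto (fun k : ℕ => 1 / ((k : ℝ) + α) ^ s) atTop (𝓝 0) := by
        have h1 : Tendsto (fun k : ℕ => ((k : ℝ) + α) ^ s) atTop atTop :=
          (tendsto_pow_atTop (by omega)).comp
            (tendsto_atTop_add_const_right _ _ tendsto_natCast_atTop_atTop)
        simpa only [one_div] using! tendsto_inv_atTop_zero.comp h1
      obtain ⟨L, hL⟩ := hanti.tendsto_alternating_series_of_tendsto_zero h0
      exact ⟨L, by simpa only [mul_one_div] using hL⟩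
  obtain ⟨L, hL⟩ := key
  rwa [lerchPhi_eq_of_tendsto hs hL]

/-! ### Bounds for blocks of the Lerch series -/

/-- Splitting off the first term `f v` leaves a shorter block of opposite leading sign, which by
induction lies between 0 and `f (v + 1) ≤ f v`. Hence the induction on the length, for all starting
points at once. -/
theorem alternating_sum_Ico_bounds {f : ℕ → ℝ} (hf : Antitone f) (h0 : ∀ k, 0 ≤ f k) (d : ℕ) :
    ∀ v, 0 ≤ (-1) ^ v * ∑ t ∈ Finset.Ico v (v + d), (-1) ^ t * f t ∧
      (-1) ^ v * ∑ t ∈ Finset.Ico v (v + d), (-1) ^ t * f t ≤ f v := by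
  induction d with
  | zero => intro v; simpa using h0 v
  | succ d ih =>
    intro v
    have hsq : ((-1 : ℝ) ^ v) * (-1) ^ v = 1 := by rw [← mul_pow]; norm_num
    rw [Finset.sum_eq_sum_Ico_succ_bot (by omega), mul_add, ← mul_assoc, hsq]
    have e : v + (d + 1) = v + 1 + d := by ring
    obtain ⟨h1, h2⟩ := ih (v + 1)
    rw [pow_succ] at h1 h2
    rw [e]
    have := hf (Nat.le_succ v)
    simp only [Nat.succ_eq_add_one] at this
    constructor <;> linarith

theorem sum_Ico_one_div_sq_le (v M : ℕ) (h : v ≤ M) :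
    ∑ t ∈ Finset.Ico v M, 1 / ((t : ℝ) + 1) ^ 2 ≤ 2 / ((v : ℝ) + 1) - 2 / ((M : ℝ) + 1) := by
  induction M, h using Nat.le_induction with
  | base => simp
  | succ M h ih =>
    rw [Finset.sum_Ico_succ_top h]
    -- The factor 2 in the telescoping majorant covers M + 2 ≤ 2(M + 1), so the bound holds from M =
    -- 0 on.
    have : 1 / ((M : ℝ) + 1) ^ 2 ≤ 2 / ((M : ℝ) + 1) - 2 / ((M : ℝ) + 1 + 1) := by
      rw [div_sub_div _ _ (by positivity) (by positivity),
        div_le_div_iff₀ (by positivity) (by positivity)]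
      have : (0 : ℝ) ≤ M := by positivity
      nlinarith [sq_nonneg ((M : ℝ) + 1)]
    push_cast
    linarith

/-- First input of the summation by parts: a bound uniform in the end `M`, by telescoping for c = 1
and by alternation for c = -1. Both cases use α(t + 1) ≤ t + α, valid because α < 1. -/
theorem abs_sum_Ico_lerch_le {c α : ℝ} {e : ℕ} (hc : c = 1 ∨ c = -1) (he : 1 ≤ e)
    (hce : c = 1 → e ≠ 1) (hα : 0 < α) (hα1 : α < 1) (v M : ℕ) (h : v ≤ M) :
    |∑ t ∈ Finset.Ico v M, c ^ t / ((t : ℝ) + α) ^ e| ≤ 2 / α ^ e / ((v : ℝ) + 1) := by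
  have hlow : ∀ t : ℕ, 1 / ((t : ℝ) + α) ^ e ≤ 1 / α ^ e * (1 / ((t : ℝ) + 1) ^ e) := by
    intro t
    rw [one_div_mul_one_div, ← mul_pow]
    have : (0 : ℝ) ≤ t := by positivity
    gcongr
    nlinarith
  rcases hc with rfl | rfl
  · have h2 : 2 ≤ e := by have := hce rfl; omega
    rw [abs_of_nonneg (Finset.sum_nonneg fun t _ => by positivity)]
    calc ∑ t ∈ Finset.Ico v M, (1 : ℝ) ^ t / ((t : ℝ) + α) ^ e
        ≤ ∑ t ∈ Finset.Ico v M, 1 / α ^ e * (1 / ((t : ℝ) + 1) ^ 2) := by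
          refine Finset.sum_le_sum fun t _ => ?_
          rw [one_pow]
          refine (hlow t).trans ?_
          gcongr
          linarith [(Nat.cast_nonneg t : (0 : ℝ) ≤ t)]
      _ ≤ 1 / α ^ e * (2 / ((v : ℝ) + 1)) := by
          rw [← Finset.mul_sum]
          gcongr
          have := sum_Ico_one_div_sq_le v M h
          have h3 : 0 ≤ 2 / ((M : ℝ) + 1) := by positivity
          linarith
      _ = 2 / α ^ e / ((v : ℝ) + 1) := by ring
  · have hanti : Antitone fun k : ℕ => 1 / ((k : ℝ) + α) ^ e := by
      intro i j hij
      have : (i : ℝ) ≤ j := by exact_mod_cast hij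
      dsimp only
      gcongr
    obtain ⟨d, rfl⟩ := Nat.exists_eq_add_of_le h
    obtain ⟨h1, h2⟩ := alternating_sum_Ico_bounds hanti (fun k => by positivity) d v
    have h3 : |∑ t ∈ Finset.Ico v (v + d), (-1 : ℝ) ^ t / ((t : ℝ) + α) ^ e|
        = (-1) ^ v * ∑ t ∈ Finset.Ico v (v + d), (-1) ^ t * (1 / ((t : ℝ) + α) ^ e) := by
      rw [← abs_of_nonneg h1, abs_mul]
      simp [div_eq_mul_inv]
    rw [h3]
    refine h2.trans ((hlow v).trans ?_)
    rw [div_right_comm, div_mul_div_comm, one_mul, div_div]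
    have hv : (0 : ℝ) ≤ v := by positivity
    have : (v : ℝ) + 1 ≤ (v + 1) ^ e := le_self_pow₀ (by linarith) (by omega)
    rw [mul_comm]
    gcongr
    norm_num

/-! ### An estimate for the error of a symmetric truncation -/

/-- The larger of the two factors is at least K and at least the smaller one, so its square root can
be traded once for √K and once for the square root of the smaller factor. What remains has the
summable exponent 3/2. -/
theorem one_div_mul_le_rpow {x y K : ℝ} (hx : 0 < x) (hy : 0 < y) (hK : 0 < K)
    (hxy : 2 * K ≤ x + y) :
    1 / (x * y) ≤ 1 / √K * (1 / x ^ (3 / 2 : ℝ) + 1 / y ^ (3 / 2 : ℝ)) := by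
  wlog hle : y ≤ x generalizing x y
  · have := this hy hx (by linarith) (by linarith)
    rwa [mul_comm, add_comm] at this
  have hKx : K ≤ x := by linarith
  have e : ∀ z : ℝ, 0 < z → z ^ (3 / 2 : ℝ) = z * √z := by
    intro z hz
    rw [Real.sqrt_eq_rpow, ← Real.rpow_one_add' hz.le (by norm_num)]
    norm_num
  have h1 : 1 / (x * y) ≤ 1 / √K * (1 / y ^ (3 / 2 : ℝ)) := by
    rw [e y hy, one_div_mul_one_div]
    refine one_div_le_one_div_of_le (by positivity) ?_
    have a1 := Real.sqrt_le_sqrt hKx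
    have a2 := Real.sqrt_le_sqrt hle
    calc √K * (y * √y) ≤ √x * (y * √x) := by gcongr
      _ = x * y := by rw [mul_comm y, ← mul_assoc, Real.mul_self_sqrt hx.le]
  refine h1.trans ?_
  gcongr
  have : 0 ≤ 1 / x ^ (3 / 2 : ℝ) := by positivity
  linarith

/-- The two factors add up to at least N + 1, so K = (N + 1)/2 is admissible in
`one_div_mul_le_rpow` and the sum is O(N^{-1/2}), uniformly in `T`. -/
theorem exists_bound_sum_one_div_mul_dist :
    ∃ ε : ℕ → ℝ, Tendsto ε atTop (𝓝 0) ∧ ∀ N T : ℕ,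
      ∑ v ∈ Finset.range T, 1 / (((v : ℝ) + 1) * (|(v : ℝ) - N| + 1)) ≤ ε N := by
  have hs1 : Summable fun k : ℕ => 1 / ((k : ℝ) + 1) ^ (3 / 2 : ℝ) := by
    refine ((Real.summable_one_div_nat_add_rpow 1 (3 / 2)).2 (by norm_num)).congr fun k => ?_
    rw [abs_of_pos (by positivity)]
  have hs2 : Summable fun k : ℤ => 1 / (|(k : ℝ)| + 1) ^ (3 / 2 : ℝ) := by
    refine Summable.of_nat_of_neg ?_ ?_ <;> simpa using hs1
  set A := ∑' k : ℕ, 1 / ((k : ℝ) + 1) ^ (3 / 2 : ℝ)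
  set B := ∑' k : ℤ, 1 / (|(k : ℝ)| + 1) ^ (3 / 2 : ℝ)
  refine ⟨fun N => 1 / √(((N : ℝ) + 1) / 2) * (A + B), ?_, fun N T => ?_⟩
  · have h1 : Tendsto (fun N : ℕ => √(((N : ℝ) + 1) / 2)) atTop atTop := by
      refine Real.tendsto_sqrt_atTop.comp ?_
      exact (tendsto_atTop_add_const_right _ _ tendsto_natCast_atTop_atTop).atTop_div_const
        (by norm_num)
    have h2 := (tendsto_inv_atTop_zero.comp h1).mul_const (A + B)
    simpa only [one_div, zero_mul] using! h2
  · calc ∑ v ∈ Finset.range T, 1 / (((v : ℝ) + 1) * (|(v : ℝ) - N| + 1))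
        ≤ ∑ v ∈ Finset.range T, 1 / √(((N : ℝ) + 1) / 2) *
          (1 / ((v : ℝ) + 1) ^ (3 / 2 : ℝ) + 1 / (|(v : ℝ) - N| + 1) ^ (3 / 2 : ℝ)) := by
          refine Finset.sum_le_sum fun v _ => ?_
          refine one_div_mul_le_rpow (by positivity) (by positivity) (by positivity) ?_
          have := neg_abs_le ((v : ℝ) - N)
          linarith
      _ ≤ 1 / √(((N : ℝ) + 1) / 2) * (A + B) := by
          rw [← Finset.mul_sum, Finset.sum_add_distrib]
          gcongr
          · exact hs1.sum_le_tsum _ fun k _ => by positivity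
          · have h3 : ∑ v ∈ Finset.range T, 1 / (|(v : ℝ) - N| + 1) ^ (3 / 2 : ℝ) =
                ∑ k ∈ (Finset.range T).image (fun v : ℕ => (v : ℤ) - N),
                  1 / (|(k : ℝ)| + 1) ^ (3 / 2 : ℝ) := by
              rw [Finset.sum_image (by intro i _ j _ hij; simpa using hij)]
              simp
            rw [h3]
            exact hs2.sum_le_tsum _ fun k _ => by positivity

/-- Summation by parts: `U t - U 0` is telescoped and the order of summation exchanged, so that each
increment of `U` meets a block of `g`. -/
theorem abs_sum_mul_sub_le {g U : ℕ → ℝ} {C D : ℝ} {N : ℕ} (hC : 0 ≤ C)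
    (hg : ∀ v M, v ≤ M → |∑ t ∈ Finset.Ico v M, g t| ≤ C / ((v : ℝ) + 1))
    (hU : ∀ t : ℕ, |U (t + 1) - U t| ≤ D / (|(t : ℝ) - N| + 1)) (T : ℕ) :
    |∑ t ∈ Finset.range T, g t * (U t - U 0)| ≤
      C * D * ∑ v ∈ Finset.range T, 1 / (((v : ℝ) + 1) * (|(v : ℝ) - N| + 1)) := by
  have e : ∑ t ∈ Finset.range T, g t * (U t - U 0) =
      ∑ v ∈ Finset.range T, (U (v + 1) - U v) * ∑ t ∈ Finset.Ico (v + 1) T, g t := by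
    calc ∑ t ∈ Finset.range T, g t * (U t - U 0)
        = ∑ t ∈ Finset.range T, ∑ v ∈ Finset.range t, (U (v + 1) - U v) * g t := by
          refine Finset.sum_congr rfl fun t _ => ?_
          rw [← Finset.sum_mul, Finset.sum_range_sub, mul_comm]
      _ = ∑ v ∈ Finset.range T, ∑ t ∈ Finset.Ico (v + 1) T, (U (v + 1) - U v) * g t := by
          refine Finset.sum_comm' fun t v => ?_
          simp only [Finset.mem_range, Finset.mem_Ico]
          omega
      _ = _ := by simp only [Finset.mul_sum]
  rw [e, Finset.mul_sum]
  refine (Finset.abs_sum_le_sum_abs _ _).trans (Finset.sum_le_sum fun v hv => ?_)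
  rw [abs_mul]
  have h1 := hU v
  have h2 := hg (v + 1) T (by simpa using hv)
  have h3 : C / (((v + 1 : ℕ) : ℝ) + 1) ≤ C / ((v : ℝ) + 1) := by
    push_cast
    gcongr
    linarith
  calc |U (v + 1) - U v| * |∑ t ∈ Finset.Ico (v + 1) T, g t|
      ≤ D / (|(v : ℝ) - N| + 1) * (C / ((v : ℝ) + 1)) := by
        refine mul_le_mul h1 (h2.trans h3) (abs_nonneg _) ((abs_nonneg _).trans h1)
    _ = C * D * (1 / (((v : ℝ) + 1) * (|(v : ℝ) - N| + 1))) := by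
        rw [div_mul_div_comm, mul_one_div]
        congr 1 <;> ring

/-! ### Symmetric sums and the function `Θ` -/

/-- The symmetric sum `∑_{|m| ≤ N} b ^ m / (x + m) ^ k` (for `b = ±1`). -/
noncomputable def symSum (b : ℝ) (k : ℕ) (x : ℝ) (N : ℕ) : ℝ :=
  1 / x ^ k + ∑ m ∈ Finset.range N,
    b ^ (m + 1) * (1 / (x + (m + 1)) ^ k + 1 / (x - (m + 1)) ^ k)

/-- Moving x by 1 moves the window |m| ≤ N by one place, so only the two end terms differ. The
identity is purely formal, hence valid also where a denominator vanishes and the quotient is 0 by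
convention. -/
theorem mul_symSum_add_one_sub {b : ℝ} (hb : b * b = 1) (k : ℕ) (x : ℝ) (N : ℕ) :
    b * symSum b k (x + 1) N - symSum b k x N =
      b ^ (N + 1) / (x + N + 1) ^ k - b ^ N / (x - N) ^ k := by
  induction N with
  | zero => simp [symSum, div_eq_mul_inv]
  | succ N ih =>
    have e : ∀ y, symSum b k y (N + 1) = symSum b k y N +
        b ^ (N + 1) * (1 / (y + (N + 1)) ^ k + 1 / (y - (N + 1)) ^ k) := by
      intro y
      rw [symSum, symSum, Finset.sum_range_succ, ← add_assoc]
    rw [e, e, mul_add]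
    have h2 : x + 1 - ((N : ℝ) + 1) = x - N := by ring
    have h3 : x + 1 + ((N : ℝ) + 1) = x + N + 1 + 1 := by ring
    have h4 : x + ((N : ℝ) + 1) = x + N + 1 := by ring
    have h5 : x + (((N + 1 : ℕ) : ℝ)) + 1 = x + N + 1 + 1 := by push_cast; ring
    have h6 : x - (((N + 1 : ℕ) : ℝ)) = x - (N + 1) := by push_cast; ring
    rw [h2, h3, h4, h5, h6]
    have hb2 : b * b ^ (N + 1) = b ^ N := by
      rw [pow_succ', ← mul_assoc, hb, one_mul]
    have hb3 : b ^ (N + 1 + 1) = b ^ N := by rw [pow_succ', hb2]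
    rw [hb3]
    linear_combination ih + (1 / (x + N + 1 + 1) ^ k + 1 / (x - N) ^ k) * hb2

/-- Second input of the summation by parts. The increment consists of the two end terms of the
window, and their denominators are bounded below by the distance of t from N because α stays away
from the integers. -/
theorem abs_symSum_step_le {b α : ℝ} (hb : b = 1 ∨ b = -1) {k : ℕ} (hk : 1 ≤ k)
    (hα : 0 < α) (hα1 : α < 1) :
    ∃ D : ℝ, ∀ N t : ℕ, |b ^ (t + 1) * symSum b k (((t + 1 : ℕ) : ℝ) + α) N
      - b ^ t * symSum b k ((t : ℝ) + α) N| ≤ D / (|(t : ℝ) - N| + 1) := by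
  have hbb : b * b = 1 := by rcases hb with rfl | rfl <;> norm_num
  have hbabs : ∀ m : ℕ, |b ^ m| = 1 := by
    intro m
    rcases hb with rfl | rfl <;> simp
  -- Half the distance from α to the integers. The half is used for t < N, where N - t - α = (N - t
  -- - 1) + (1 - α) must dominate κ(N - t - 1) + 2κ.
  set κ := min α (1 - α) / 2 with hκ
  have hκ0 : 0 < κ := by
    have : 0 < min α (1 - α) := lt_min hα (by linarith)
    positivity
  have hκ1 : κ ≤ α / 2 := by have := min_le_left α (1 - α); linarith
  have hκ2 : κ ≤ (1 - α) / 2 := by have := min_le_right α (1 - α); linarith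
  refine ⟨2 / κ ^ k, fun N t => ?_⟩
  have e : b ^ (t + 1) * symSum b k (((t + 1 : ℕ) : ℝ) + α) N - b ^ t * symSum b k ((t : ℝ) + α) N
      = b ^ t * (b ^ (N + 1) / ((t : ℝ) + α + N + 1) ^ k - b ^ N / ((t : ℝ) + α - N) ^ k) := by
    rw [← mul_symSum_add_one_sub hbb]
    have : ((t + 1 : ℕ) : ℝ) + α = (t : ℝ) + α + 1 := by push_cast; ring
    rw [this]
    ring
  have gen : ∀ y : ℝ, κ * (|(t : ℝ) - N| + 1) ≤ |y| → ∀ m : ℕ,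
      |b ^ m / y ^ k| ≤ 1 / κ ^ k / (|(t : ℝ) - N| + 1) := by
    intro y hy m
    rw [abs_div, hbabs, abs_pow, div_div]
    have h1 : (0 : ℝ) < |(t : ℝ) - N| + 1 := by positivity
    refine one_div_le_one_div_of_le (by positivity) ?_
    calc κ ^ k * (|(t : ℝ) - N| + 1) ≤ κ ^ k * (|(t : ℝ) - N| + 1) ^ k := by
          gcongr
          exact le_self_pow₀ (by linarith [abs_nonneg ((t : ℝ) - N)]) (by omega)
      _ = (κ * (|(t : ℝ) - N| + 1)) ^ k := by rw [mul_pow]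
      _ ≤ |y| ^ k := by gcongr
  rw [e, abs_mul, hbabs, one_mul]
  have ht : (0 : ℝ) ≤ t := Nat.cast_nonneg t
  have hN : (0 : ℝ) ≤ N := Nat.cast_nonneg N
  have h1 := gen ((t : ℝ) + α + N + 1) (by
    rw [abs_of_pos (a := (t : ℝ) + α + N + 1) (by positivity)]
    have : |(t : ℝ) - N| ≤ t + N := by rw [abs_le]; constructor <;> linarith
    nlinarith [abs_nonneg ((t : ℝ) - N)]) (N + 1)
  have h2 := gen ((t : ℝ) + α - N) (by
    rcases le_or_gt N t with h | h
    · have h' : (N : ℝ) ≤ t := by exact_mod_cast h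
      rw [abs_of_nonneg (by linarith), abs_of_nonneg (by linarith)]
      nlinarith
    · have h' : (t : ℝ) + 1 ≤ N := by exact_mod_cast h
      rw [abs_of_nonpos (by linarith), abs_of_nonpos (by linarith)]
      nlinarith) N
  calc _ ≤ _ := abs_sub _ _
    _ ≤ _ := add_le_add h1 h2
    _ = _ := by ring

/-- The Mittag-Leffler expansion of π cot(πx), taken over the complex numbers and restricted to real
x. -/
theorem tendsto_symSum_one_one {x : ℝ} (h0 : 0 < x) (h1 : x < 1) :
    Tendsto (symSum 1 1 x) atTop (𝓝 (Real.pi * Real.cot (Real.pi * x))) := by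
  have hz : (x : ℂ) ∈ Complex.integerComplement := by
    rintro ⟨m, hm⟩
    have hm' : (m : ℝ) = x := by exact_mod_cast hm
    rw [← hm'] at h0 h1
    have h2 : 0 < m := by exact_mod_cast h0
    have h3 : m < 1 := by exact_mod_cast h1
    omega
  have hT := tendsto_logDeriv_euler_cot_sub hz
  have h3 : Tendsto (fun N : ℕ => ((symSum 1 1 x N - 1 / x : ℝ) : ℂ)) atTop
      (𝓝 ((Real.pi * Real.cot (Real.pi * x) - 1 / x : ℝ) : ℂ)) := by
    convert hT using 2
    · rw [symSum]
      push_cast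
      simp [cotTerm, add_comm]
    · push_cast
      rfl
  have h4 : Tendsto (fun N : ℕ => (symSum 1 1 x N - 1 / x : ℝ)) atTop
      (𝓝 ((Real.pi * Real.cot (Real.pi * x) - 1 / x : ℝ))) := by
    have := (Complex.continuous_re.tendsto _).comp h3
    simpa only [Function.comp_def, Complex.ofReal_re] using this
  simpa using h4.add_const (1 / x)

theorem symSum_eq_sum_add_sum {b : ℝ} (k : ℕ) (x : ℝ) (N : ℕ) :
    symSum b k x N = ∑ m ∈ Finset.range (N + 1), b ^ m / ((m : ℝ) + x) ^ k +
      b * (-1) ^ k * ∑ m ∈ Finset.range N, b ^ m / ((m : ℝ) + (1 - x)) ^ k := by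
  rw [symSum, Finset.sum_range_succ', Finset.mul_sum]
  have hsgn : ∀ m : ℕ, 1 / (x - (m + 1)) ^ k = (-1) ^ k / ((m : ℝ) + (1 - x)) ^ k := by
    intro m
    have : x - ((m : ℝ) + 1) = (-1) * (m + (1 - x)) := by ring
    rw [this, mul_pow]
    rcases neg_one_pow_eq_or ℝ k with h | h <;> rw [h]
    · simp
    · rw [neg_one_mul, div_neg, neg_div]
  simp only [hsgn]
  have : ∀ m : ℕ, b ^ (m + 1) * (1 / (x + (m + 1)) ^ k + (-1) ^ k / ((m : ℝ) + (1 - x)) ^ k) =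
      b ^ (m + 1) / (((m + 1 : ℕ) : ℝ) + x) ^ k +
        b * (-1) ^ k * (b ^ m / ((m : ℝ) + (1 - x)) ^ k) := by
    intro m
    have : x + ((m : ℝ) + 1) = ((m + 1 : ℕ) : ℝ) + x := by push_cast; ring
    rw [this]
    ring
  simp only [this, Finset.sum_add_distrib]
  simp
  ring

/-- This explains the exceptional value of Θ: for b = k = 1 the positive and negative halves diverge
separately, and only the symmetric sum has a limit, the cotangent. Otherwise the negative half is
reflected into a Lerch series at 1 - x. -/
theorem tendsto_symSum {b s r : ℝ} (hb : b = 1 ∨ b = -1) {k : ℕ} (hk : 1 ≤ k)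
    (hs : 0 < s) (hr : s < r) :
    Tendsto (symSum b k (s / r)) atTop (𝓝 (lerchTheta b k s r)) := by
  have hr0 : 0 < r := hs.trans hr
  have hx0 : 0 < s / r := by positivity
  have hx1 : s / r < 1 := (div_lt_one hr0).2 hr
  rw [lerchTheta]
  split_ifs with h
  · obtain ⟨rfl, rfl⟩ := h
    rw [mul_div_assoc]
    exact tendsto_symSum_one_one hx0 hx1
  · have hbk : b = 1 → k ≠ 1 := fun h1 h2 => h ⟨h1, h2⟩
    have e : (r - s) / r = 1 - s / r := by field_simp
    rw [e]
    have t1 := tendsto_sum_lerchPhi hb hk hbk hx0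
    have t2 := tendsto_sum_lerchPhi hb hk hbk (α := 1 - s / r) (by linarith)
    refine ((t1.comp (tendsto_add_atTop_nat 1)).add (t2.const_mul (b * (-1) ^ k))).congr ?_
    intro N
    rw [symSum_eq_sum_add_sum]
    rfl

/-- Reflection of the symmetric sum, m → -m. It serves to pass from the index 2j + 1, natural in the
double sum, to the 2j - 1 of the final formula. -/
theorem lerchTheta_sub {b s r : ℝ} (hb : b = 1 ∨ b = -1) {k : ℕ} (hr : r ≠ 0) :
    lerchTheta b k (r - s) r = b * (-1) ^ k * lerchTheta b k s r := by
  rw [lerchTheta, lerchTheta]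
  split_ifs with h
  · obtain ⟨rfl, rfl⟩ := h
    have : Real.pi * (r - s) / r = Real.pi - Real.pi * s / r := by field_simp
    rw [this, Real.cot_eq_cos_div_sin, Real.cot_eq_cos_div_sin, Real.cos_pi_sub, Real.sin_pi_sub]
    ring
  · rw [sub_sub_cancel]
    have h1 : ((-1 : ℝ) ^ k) * (-1) ^ k = 1 := by rw [← mul_pow]; norm_num
    have h2 : b * b = 1 := by rcases hb with rfl | rfl <;> norm_num
    linear_combination -lerchPhi b k ((r - s) / r) * ((-1 : ℝ) ^ k * (-1) ^ k * h2 + h1)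

/-! ### Partial fractions -/

/-- Half of the partial fraction decomposition of `1 / (z ^ p * (z + β) ^ q)`. -/
noncomputable def pfSum (σ β z : ℝ) (p q : ℕ) : ℝ :=
  ∑ r ∈ Finset.range p, σ ^ r * ((q + r - 1).choose r : ℝ) / (β ^ (q + r) * z ^ (p - r))

/-- Pascal's rule for the coefficients; it matches the recursion that `1 / (z ^ p * (z + β) ^ q)`
obeys because β = (z + β) - z. -/
theorem mul_pfSum_succ_succ {β z : ℝ} (σ : ℝ) (hβ : β ≠ 0) (hz : z ≠ 0) (p q : ℕ) :
    β * pfSum σ β z (p + 1) (q + 1) = pfSum σ β z (p + 1) q + σ * pfSum σ β z p (q + 1) := by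
  simp only [pfSum, Finset.mul_sum]
  rw [Finset.sum_range_succ', Finset.sum_range_succ' _ p]
  conv_rhs => rw [add_right_comm, ← Finset.sum_add_distrib]
  congr 1
  · refine Finset.sum_congr rfl fun r _ => ?_
    have e1 : q + 1 + (r + 1) - 1 = (q + r) + 1 := by omega
    have e2 : q + (r + 1) - 1 = q + r := by omega
    have e3 : q + 1 + r - 1 = q + r := by omega
    have e4 : p + 1 - (r + 1) = p - r := by omega
    rw [e1, e2, e3, e4, Nat.choose_succ_succ]
    push_cast
    field_simp
    ring
  · simp
    field_simp
    ring

/-- Induction on p + q: dividing β = (z + β) - z by the product lowers one exponent at a time. The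
case p = q = 0 is excluded because both halves are then empty. -/
theorem one_div_pow_mul_pow_eq_pfSum {β z : ℝ} (hβ : β ≠ 0) (hz : z ≠ 0) (hy : z + β ≠ 0) :
    ∀ s p q : ℕ, p + q = s → 1 ≤ s →
      1 / (z ^ p * (z + β) ^ q) = pfSum (-1) β z p q + (-1) ^ p * pfSum 1 β (z + β) q p := by
  intro s
  induction s with
  | zero => intro p q _ h; omega
  | succ s ih =>
    intro p q hpq _
    -- With one exponent 0 only r = 0 survives: truncated subtraction gives `(0 - 1).choose 0 = 1`,
    -- while `(r - 1).choose r = 0` for r ≥ 1.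
    have triv : ∀ σ w : ℝ, ∀ n : ℕ, pfSum σ β w (n + 1) 0 = 1 / w ^ (n + 1) := by
      intro σ w n
      rw [pfSum, Finset.sum_range_succ', Finset.sum_eq_zero]
      · simp
      · intro r _
        simp
    rcases p with _ | p
    · rcases q with _ | q
      · omega
      · rw [triv]; simp [pfSum]
    rcases q with _ | q
    · rw [triv]; simp [pfSum]
    have h1 := ih (p + 1) q (by omega) (by omega)
    have h2 := ih p (q + 1) (by omega) (by omega)
    have m1 := mul_pfSum_succ_succ (-1) hβ hz p q
    have m2 := mul_pfSum_succ_succ 1 hβ hy q p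
    have key : β * (1 / (z ^ (p + 1) * (z + β) ^ (q + 1))) =
        1 / (z ^ (p + 1) * (z + β) ^ q) - 1 / (z ^ p * (z + β) ^ (q + 1)) := by
      field_simp
      ring
    refine mul_left_cancel₀ hβ ?_
    rw [key, h1, h2, mul_add, m1]
    linear_combination (-1 : ℝ) * (-1) ^ (p + 1) * m2

theorem sum_range_sub_eq_sum_Icc (f : ℕ → ℕ → ℝ) (p : ℕ) :
    ∑ r ∈ Finset.range p, f r (p - r) = ∑ i ∈ Finset.Icc 1 p, f (p - i) i := by
  refine Finset.sum_nbij' (fun r => p - r) (fun i => p - i) ?_ ?_ ?_ ?_ ?_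
  · intro r hr; simp at hr ⊢; omega
  · intro r hr; simp at hr ⊢; omega
  · intro r hr; simp at hr ⊢; omega
  · intro r hr; simp at hr ⊢; omega
  · intro r hr
    simp at hr
    congr 1
    omega

theorem one_div_pow_mul_pow {β z : ℝ} (hβ : β ≠ 0) (hz : z ≠ 0) (hy : z + β ≠ 0) {p q : ℕ}
    (hp : 1 ≤ p) (hq : 1 ≤ q) :
    1 / (z ^ p * (z + β) ^ q) =
      ∑ i ∈ Finset.Icc 1 p,
        (-1) ^ (p - i) * ((p + q - i - 1).choose (q - 1) : ℝ) / (β ^ (p + q - i) * z ^ i) +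
      (-1) ^ p * ∑ k ∈ Finset.Icc 1 q,
        ((p + q - k - 1).choose (p - 1) : ℝ) / (β ^ (p + q - k) * (z + β) ^ k) := by
  rw [one_div_pow_mul_pow_eq_pfSum hβ hz hy _ p q rfl (by omega), pfSum, pfSum,
    sum_range_sub_eq_sum_Icc
      (fun r i => (-1 : ℝ) ^ r * ((q + r - 1).choose r : ℝ) / (β ^ (q + r) * z ^ i)) p,
    sum_range_sub_eq_sum_Icc
      (fun r i => (1 : ℝ) ^ r * ((p + r - 1).choose r : ℝ) / (β ^ (p + r) * (z + β) ^ i)) q]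
  congr 1
  · refine Finset.sum_congr rfl fun i hi => ?_
    rw [Finset.mem_Icc] at hi
    rw [show q + (p - i) - 1 = p + q - i - 1 by omega, show q + (p - i) = p + q - i by omega,
      ← Nat.choose_symm (show q - 1 ≤ p + q - i - 1 by omega),
      show p + q - i - 1 - (q - 1) = p - i by omega]
  · congr 1
    refine Finset.sum_congr rfl fun i hi => ?_
    rw [Finset.mem_Icc] at hi
    rw [show p + (q - i) - 1 = p + q - i - 1 by omega, show p + (q - i) = p + q - i by omega,
      ← Nat.choose_symm (show p - 1 ≤ p + q - i - 1 by omega),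
      show p + q - i - 1 - (p - 1) = q - i by omega, one_pow, one_mul]

/-! ### Approximate double limits -/

/-- `X N T` is, for large `T`, within a null sequence (in `N`) of `v`. -/
def IterLim (X : ℕ → ℕ → ℝ) (v : ℝ) : Prop :=
  ∃ δ : ℕ → ℝ, Tendsto δ atTop (𝓝 0) ∧ ∀ N, ∀ᶠ T in atTop, |X N T - v| ≤ δ N

namespace IterLim

variable {X Y : ℕ → ℕ → ℝ} {v w : ℝ}

theorem zero : IterLim (fun _ _ => 0) 0 :=
  ⟨fun _ => 0, tendsto_const_nhds, fun N => Eventually.of_forall fun T => by simp⟩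

theorem add (hX : IterLim X v) (hY : IterLim Y w) :
    IterLim (fun N T => X N T + Y N T) (v + w) := by
  obtain ⟨δ, hδ, h1⟩ := hX
  obtain ⟨ε, hε, h2⟩ := hY
  refine ⟨fun N => δ N + ε N, by simpa using hδ.add hε, fun N => ?_⟩
  filter_upwards [h1 N, h2 N] with T t1 t2
  calc |X N T + Y N T - (v + w)| = |(X N T - v) + (Y N T - w)| := by ring_nf
    _ ≤ _ := (abs_add_le _ _).trans (add_le_add t1 t2)

theorem const_mul (c : ℝ) (hX : IterLim X v) : IterLim (fun N T => c * X N T) (c * v) := by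
  obtain ⟨δ, hδ, h1⟩ := hX
  refine ⟨fun N => |c| * δ N, by simpa using hδ.const_mul |c|, fun N => ?_⟩
  filter_upwards [h1 N] with T t1
  rw [← mul_sub, abs_mul]
  gcongr

theorem sum {ι : Type*} (s : Finset ι) {X : ι → ℕ → ℕ → ℝ} {v : ι → ℝ}
    (h : ∀ i ∈ s, IterLim (X i) (v i)) :
    IterLim (fun N T => ∑ i ∈ s, X i N T) (∑ i ∈ s, v i) := by
  classical
  induction s using Finset.induction_on with
  | empty => simpa using zero
  | insert i s hi ih =>
    simp only [Finset.sum_insert hi]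
    exact (h i (Finset.mem_insert_self _ _)).add
      (ih fun j hj => h j (Finset.mem_insert_of_mem hj))

theorem mul_of_tendsto {u z : ℕ → ℝ} (hu : Tendsto u atTop (𝓝 v)) (hz : Tendsto z atTop (𝓝 w)) :
    IterLim (fun N T => u N * z T) (v * w) := by
  -- Any positive null sequence would serve as 1/(N + 1), since the threshold for T may depend on N.
  refine ⟨fun N => 1 / ((N : ℝ) + 1) + |u N * w - v * w|, ?_, fun N => ?_⟩
  · have h1 : Tendsto (fun N => |u N * w - v * w|) atTop (𝓝 0) := by
      have := ((hu.mul_const w).sub_const (v * w)).abs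
      simpa using this
    simpa using tendsto_one_div_add_atTop_nhds_zero_nat.add h1
  · have h2 : Tendsto (fun T => |u N * z T - u N * w|) atTop (𝓝 0) := by
      have := ((hz.const_mul (u N)).sub_const (u N * w)).abs
      simpa using this
    have hpos : (0 : ℝ) < 1 / ((N : ℝ) + 1) := by positivity
    filter_upwards [h2.eventually (gt_mem_nhds hpos)] with T hT
    calc |u N * z T - v * w| ≤ |u N * z T - u N * w| + |u N * w - v * w| := abs_sub_le _ _ _
      _ ≤ _ := by linarith

theorem of_abs_sub_le {ε : ℕ → ℝ} (hX : IterLim X v) (hε : Tendsto ε atTop (𝓝 0))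
    (h : ∀ N T, |Y N T - X N T| ≤ ε N) : IterLim Y v := by
  obtain ⟨δ, hδ, h1⟩ := hX
  refine ⟨fun N => ε N + δ N, by simpa using hε.add hδ, fun N => ?_⟩
  filter_upwards [h1 N] with T t1
  exact (abs_sub_le _ _ _).trans (add_le_add (h N T) t1)

/-- Letting T → ∞ at fixed N turns the bound into |x N - v| ≤ δ N. This is how the two orders of
summation are compared. -/
theorem eq_of_tendsto {x : ℕ → ℝ} (hX : IterLim X v) (hx : ∀ N, Tendsto (X N) atTop (𝓝 (x N)))
    (hw : Tendsto x atTop (𝓝 w)) : w = v := by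
  obtain ⟨δ, hδ, h1⟩ := hX
  have h2 : ∀ N, |x N - v| ≤ δ N := fun N =>
    le_of_tendsto ((hx N).sub_const v).abs (h1 N)
  have h3 : Tendsto (fun N => x N - v) atTop (𝓝 0) :=
    squeeze_zero_norm h2 hδ
  have h4 := hw.sub_const v
  linarith [tendsto_nhds_unique h3 h4]

end IterLim

/-! ### The double sum -/

/-- The exchange of limits. Up to an error that vanishes with N uniformly in T, the factor `b ^ t *
symSum b k (t + s / r) N` may be replaced by its value at t = 0, after which the double sum is a
product. -/
theorem iterLim_symSum {b c s r : ℝ} (hb : b = 1 ∨ b = -1) (hc : c = 1 ∨ c = -1) {k e : ℕ}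
    (hk : 1 ≤ k) (he : 1 ≤ e) (hce : c = 1 → e ≠ 1) (hs : 0 < s) (hr : s < r) :
    IterLim (fun N T => ∑ t ∈ Finset.range T,
        c ^ t / ((t : ℝ) + s / r) ^ e * (b ^ t * symSum b k ((t : ℝ) + s / r) N))
      (lerchTheta b k s r * lerchPhi c e (s / r)) := by
  have hr0 : 0 < r := hs.trans hr
  have hx0 : 0 < s / r := by positivity
  have hx1 : s / r < 1 := (div_lt_one hr0).2 hr
  obtain ⟨D, hD⟩ := abs_symSum_step_le hb hk hx0 hx1
  obtain ⟨ε, hε, hεb⟩ := exists_bound_sum_one_div_mul_dist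
  have hD0 : 0 ≤ D := by
    have := (abs_nonneg _).trans (hD 0 0)
    simpa using this
  refine (IterLim.mul_of_tendsto (tendsto_symSum hb hk hs hr)
    (tendsto_sum_lerchPhi hc he hce hx0)).of_abs_sub_le
      (ε := fun N => 2 / (s / r) ^ e * D * ε N) (by simpa using hε.const_mul _) fun N T => ?_
  have h := abs_sum_mul_sub_le (C := 2 / (s / r) ^ e)
    (U := fun t => b ^ t * symSum b k ((t : ℝ) + s / r) N) (by positivity)
    (abs_sum_Ico_lerch_le hc he hce hx0 hx1) (hD N) T
  refine le_trans (le_of_eq ?_) (h.trans (mul_le_mul_of_nonneg_left (hεb N T) (by positivity)))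
  congr 1
  rw [Finset.mul_sum, ← Finset.sum_sub_distrib]
  refine Finset.sum_congr rfl fun t _ => ?_
  simp
  ring

theorem sum_range_mul_eq (f : ℕ → ℝ) (n T : ℕ) :
    ∑ l ∈ Finset.range (n * T), f l =
      ∑ j ∈ Finset.range n, ∑ t ∈ Finset.range T, f (n * t + j) := by
  induction T with
  | zero => simp
  | succ T ih =>
    rw [Nat.mul_succ, Finset.sum_range_add, ih, ← Finset.sum_add_distrib]
    simp only [Finset.sum_range_succ]

/-- The coefficient `∑_{0 < |m| ≤ N} b ^ m / m ^ i`. -/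
noncomputable def symZeta (b : ℝ) (i N : ℕ) : ℝ :=
  ∑ m ∈ Finset.range N, b ^ (m + 1) * ((1 + (-1) ^ i) / ((m : ℝ) + 1) ^ i)

/-- For odd i the terms of m and -m cancel identically, so the divergent case b = i = 1 does no
harm; for even i the two halves agree. -/
theorem tendsto_symZeta {b : ℝ} (hb : b = 1 ∨ b = -1) {i : ℕ} (hi : 1 ≤ i) :
    Tendsto (symZeta b i) atTop (𝓝 ((1 + (-1) ^ i) * (b * lerchPhi b i 1))) := by
  have e : ∀ N, symZeta b i N =
      (1 + (-1) ^ i) * (b * ∑ m ∈ Finset.range N, b ^ m / ((m : ℝ) + 1) ^ i) := by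
    intro N
    rw [symZeta, Finset.mul_sum, Finset.mul_sum]
    refine Finset.sum_congr rfl fun m _ => ?_
    ring
  rcases Nat.even_or_odd i with h | h
  · have hi2 : b = 1 → i ≠ 1 := by rintro _ rfl; simp at h
    exact (((tendsto_sum_lerchPhi hb hi hi2 one_pos).const_mul b).const_mul _).congr
      fun N => (e N).symm
  · have : (1 + (-1 : ℝ) ^ i) = 0 := by rw [h.neg_one_pow]; norm_num
    simp only [this, zero_mul] at e ⊢
    exact tendsto_const_nhds.congr fun N => (e N).symm

/-- Partial fractions at z = n(m + 1) and z = -n(m + 1), with the sum over m carried out on each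
fraction. The index m = 0 is absent on the left but present in `symSum`, whence the subtracted `1 /
β ^ (p + q)`. -/
theorem sum_symmetric_eq {b β : ℝ} {n p q : ℕ} (hn : 1 ≤ n) (hp : 1 ≤ p) (hq : 1 ≤ q)
    (hβ : ∀ m : ℤ, (n : ℝ) * m + β ≠ 0) (N : ℕ) :
    ∑ m ∈ Finset.range N, b ^ (m + 1) / ((m : ℝ) + 1) ^ p *
        (1 / ((n : ℝ) * (m + 1) + β) ^ q + (-1) ^ p * (1 / (β - (n : ℝ) * (m + 1)) ^ q)) =
      (n : ℝ) ^ p * (∑ i ∈ Finset.Icc 1 p,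
          (-1) ^ (p - i) * ((p + q - i - 1).choose (q - 1) : ℝ) / (n : ℝ) ^ i * symZeta b i N *
            (1 / β ^ (p + q - i)) +
        (-1) ^ p * ∑ k ∈ Finset.Icc 1 q, ((p + q - k - 1).choose (p - 1) : ℝ) *
            (1 / (n : ℝ) ^ k * (symSum b k (β / n) N / β ^ (p + q - k)) - 1 / β ^ (p + q))) := by
  have hn0 : (n : ℝ) ≠ 0 := by positivity
  have hβ0 : β ≠ 0 := by simpa using hβ 0
  have step : ∀ m : ℕ, b ^ (m + 1) / ((m : ℝ) + 1) ^ p *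
        (1 / ((n : ℝ) * (m + 1) + β) ^ q + (-1) ^ p * (1 / (β - (n : ℝ) * (m + 1)) ^ q)) =
      (n : ℝ) ^ p * (∑ i ∈ Finset.Icc 1 p,
          (-1) ^ (p - i) * ((p + q - i - 1).choose (q - 1) : ℝ) / (n : ℝ) ^ i *
            (b ^ (m + 1) * ((1 + (-1) ^ i) / ((m : ℝ) + 1) ^ i)) * (1 / β ^ (p + q - i)) +
        (-1) ^ p * ∑ k ∈ Finset.Icc 1 q, ((p + q - k - 1).choose (p - 1) : ℝ) *
            (1 / (n : ℝ) ^ k * (b ^ (m + 1) * (1 / (β / n + (m + 1)) ^ k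
              + 1 / (β / n - (m + 1)) ^ k) / β ^ (p + q - k)))) := by
    intro m
    have hm0 : (m : ℝ) + 1 ≠ 0 := by positivity
    have hz1 : (n : ℝ) * (m + 1) ≠ 0 := mul_ne_zero hn0 hm0
    have hz2 : -((n : ℝ) * (m + 1)) ≠ 0 := neg_ne_zero.2 hz1
    have hy1 : (n : ℝ) * (m + 1) + β ≠ 0 := by simpa using hβ (m + 1)
    have hy2 : -((n : ℝ) * (m + 1)) + β ≠ 0 := by
      have := hβ (-(m + 1))
      push_cast at this
      rwa [mul_neg] at this
    have P1 := one_div_pow_mul_pow hβ0 hz1 hy1 hp hq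
    have P2 := one_div_pow_mul_pow hβ0 hz2 hy2 hp hq
    have sq : ∀ i : ℕ, ((-1 : ℝ) ^ i) * (-1) ^ i = 1 := by
      intro i; rw [← mul_pow]; norm_num
    have inv : ∀ i : ℕ, 1 / (-((n : ℝ) * (m + 1))) ^ i = (-1) ^ i / ((n : ℝ) * (m + 1)) ^ i := by
      intro i
      rw [neg_pow, div_eq_div_iff (mul_ne_zero (by simp) (pow_ne_zero _ hz1)) (pow_ne_zero _ hz1),
        ← mul_assoc, sq]
    have L : b ^ (m + 1) / ((m : ℝ) + 1) ^ p *
        (1 / ((n : ℝ) * (m + 1) + β) ^ q + (-1) ^ p * (1 / (β - (n : ℝ) * (m + 1)) ^ q)) =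
        b ^ (m + 1) * (n : ℝ) ^ p * (1 / (((n : ℝ) * (m + 1)) ^ p * ((n : ℝ) * (m + 1) + β) ^ q)
          + 1 / ((-((n : ℝ) * (m + 1))) ^ p * (-((n : ℝ) * (m + 1)) + β) ^ q)) := by
      rw [← one_div_mul_one_div, ← one_div_mul_one_div (_ ^ p), inv,
        show -((n : ℝ) * (m + 1)) + β = β - (n : ℝ) * (m + 1) by ring, mul_pow]
      have hy3 : β - (n : ℝ) * (m + 1) ≠ 0 := by rwa [neg_add_eq_sub] at hy2
      field_simp
    rw [L, P1, P2]
    have S1 : ∀ i, (-1 : ℝ) ^ (p - i) * ((p + q - i - 1).choose (q - 1) : ℝ) / (n : ℝ) ^ i *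
            (b ^ (m + 1) * ((1 + (-1) ^ i) / ((m : ℝ) + 1) ^ i)) * (1 / β ^ (p + q - i)) =
        b ^ (m + 1) * ((-1) ^ (p - i) * ((p + q - i - 1).choose (q - 1) : ℝ) /
            (β ^ (p + q - i) * ((n : ℝ) * (m + 1)) ^ i)) +
        b ^ (m + 1) * ((-1) ^ (p - i) * ((p + q - i - 1).choose (q - 1) : ℝ) /
            (β ^ (p + q - i) * (-((n : ℝ) * (m + 1))) ^ i)) := by
      intro i
      have : ∀ u w x : ℝ, u / (w * x) = u / w * (1 / x) := by
        intro u w x; rw [div_mul_div_comm, mul_one]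
      rw [this _ _ ((-((n : ℝ) * (m + 1))) ^ i), inv, mul_pow]
      field_simp
    have S2 : ∀ k, ((p + q - k - 1).choose (p - 1) : ℝ) *
            (1 / (n : ℝ) ^ k * (b ^ (m + 1) * (1 / (β / n + (m + 1)) ^ k
              + 1 / (β / n - (m + 1)) ^ k) / β ^ (p + q - k))) =
        b ^ (m + 1) * (((p + q - k - 1).choose (p - 1) : ℝ) /
          (β ^ (p + q - k) * ((n : ℝ) * (m + 1) + β) ^ k)) +
        b ^ (m + 1) * (((p + q - k - 1).choose (p - 1) : ℝ) /
          (β ^ (p + q - k) * (-((n : ℝ) * (m + 1)) + β) ^ k)) := by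
      intro k
      have e1 : (n : ℝ) * (m + 1) + β = n * (β / n + (m + 1)) := by field_simp; ring
      have e2 : -((n : ℝ) * (m + 1)) + β = n * (β / n - (m + 1)) := by field_simp; ring
      rw [e1, e2, mul_pow, mul_pow]
      have g1 : β / n + ((m : ℝ) + 1) ≠ 0 := by
        intro h; rw [e1, h, mul_zero] at hy1; exact hy1 rfl
      have g2 : β / n - ((m : ℝ) + 1) ≠ 0 := by
        intro h; rw [e2, h, mul_zero] at hy2; exact hy2 rfl
      generalize β / n + ((m : ℝ) + 1) = G1 at *
      generalize β / n - ((m : ℝ) + 1) = G2 at *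
      field_simp
    simp only [S1, S2, Finset.sum_add_distrib, ← Finset.mul_sum]
    ring
  rw [Finset.sum_congr rfl fun m _ => step m, ← Finset.mul_sum, Finset.sum_add_distrib,
    ← Finset.mul_sum, Finset.sum_comm, Finset.sum_comm (s := Finset.range N)]
  congr 2
  · refine Finset.sum_congr rfl fun i _ => ?_
    rw [symZeta, Finset.mul_sum, Finset.sum_mul]
  · congr 1
    refine Finset.sum_congr rfl fun k hk => ?_
    rw [Finset.mem_Icc] at hk
    rw [← Finset.mul_sum, ← Finset.mul_sum, ← Finset.sum_div]
    congr 1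
    -- The central term (β/n)^{-k} of `symSum` produces the same correction for every k.
    have e : 1 / β ^ (p + q) = 1 / (n : ℝ) ^ k * (1 / (β / n) ^ k / β ^ (p + q - k)) := by
      rw [show p + q = k + (p + q - k) by omega, pow_add, div_pow,
        show k + (p + q - k) - k = p + q - k by omega]
      field_simp
    rw [e, symSum]
    ring

theorem sq_eq_one_of_sign {a : ℝ} (ha : a = 1 ∨ a = -1) : a * a = 1 := by
  rcases ha with rfl | rfl <;> norm_num

theorem pow_mul_pow_of_sign {a : ℝ} (ha : a = 1 ∨ a = -1) (m : ℕ) : a ^ m * a ^ m = 1 := by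
  rw [← mul_pow, sq_eq_one_of_sign ha, one_pow]

theorem sign_pow {a : ℝ} (ha : a = 1 ∨ a = -1) (m : ℕ) : a ^ m = 1 ∨ a ^ m = -1 := by
  rcases ha with rfl | rfl
  · simp
  · exact neg_one_pow_eq_or ℝ m

theorem sign_mul {a b : ℝ} (ha : a = 1 ∨ a = -1) (hb : b = 1 ∨ b = -1) :
    a * b = 1 ∨ a * b = -1 := by
  rcases ha with rfl | rfl <;> rcases hb with rfl | rfl <;> norm_num

theorem pow_mul_lerchPhi_add {a α : ℝ} {q : ℕ} (ha : a = 1 ∨ a = -1) (hq : 1 ≤ q)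
    (haq : a = 1 → q ≠ 1) (hα : 0 < α) (K : ℕ) :
    a ^ K * lerchPhi a q (K + α) =
      lerchPhi a q α - ∑ l ∈ Finset.range K, a ^ l / ((l : ℝ) + α) ^ q := by
  have t1 := (tendsto_sum_lerchPhi ha hq haq (α := K + α) (by positivity)).const_mul (a ^ K)
  have t2 := ((tendsto_sum_lerchPhi ha hq haq hα).comp (tendsto_add_atTop_nat K)).sub_const
    (∑ l ∈ Finset.range K, a ^ l / ((l : ℝ) + α) ^ q)
  refine tendsto_nhds_unique t1 (t2.congr fun L => ?_)
  simp only [Function.comp_apply]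
  rw [add_comm, Finset.sum_range_add, add_sub_cancel_left, Finset.mul_sum]
  refine Finset.sum_congr rfl fun l _ => ?_
  rw [pow_add, mul_div_assoc]
  congr 3
  push_cast
  ring

/-- The first K terms have negative base; under l → K - 1 - l they become, up to sign, a partial sum
of Φ(a, q, 1/2). The terms from K on are that series itself, shifted. -/
theorem tendsto_sum_half_sub {a : ℝ} {q : ℕ} (ha : a = 1 ∨ a = -1) (hq : 1 ≤ q)
    (haq : a = 1 → q ≠ 1) (K : ℕ) :
    Tendsto (fun L => ∑ l ∈ Finset.range L, a ^ l * (1 / ((l : ℝ) + 1 / 2 - K) ^ q)) atTop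
      (𝓝 (a ^ K * (lerchPhi a q (1 / 2) + (-1) ^ q * a *
        ∑ l ∈ Finset.range K, a ^ l / ((l : ℝ) + 1 / 2) ^ q))) := by
  rw [← tendsto_add_atTop_iff_nat K]
  have t1 := ((tendsto_sum_lerchPhi ha hq haq (α := 1 / 2) (by norm_num)).add_const
    ((-1) ^ q * a * ∑ l ∈ Finset.range K, a ^ l / ((l : ℝ) + 1 / 2) ^ q)).const_mul (a ^ K)
  refine t1.congr fun L => ?_
  have A : ∑ l ∈ Finset.range K, a ^ l * (1 / ((l : ℝ) + 1 / 2 - K) ^ q) =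
      a ^ K * ((-1) ^ q * a * ∑ l ∈ Finset.range K, a ^ l / ((l : ℝ) + 1 / 2) ^ q) := by
    rw [← Finset.sum_range_reflect, Finset.mul_sum, Finset.mul_sum]
    refine Finset.sum_congr rfl fun l hl => ?_
    rw [Finset.mem_range] at hl
    have e : ((K - 1 - l : ℕ) : ℝ) = K - 1 - l := by
      rw [Nat.cast_sub (by omega), Nat.cast_sub (by omega)]; simp
    have e2 : (K : ℝ) - 1 - l + 1 / 2 - K = (-1) * (l + 1 / 2) := by ring
    have e3 : a ^ K * a ^ l = a ^ (K - 1 - l) * a := by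
      have h1 : a ^ K = a ^ (K - 1 - l) * a * a ^ l := by
        rw [← pow_succ, ← pow_add]; congr 1; omega
      rw [h1, mul_assoc, pow_mul_pow_of_sign ha, mul_one]
    have e4 : (1 : ℝ) / (-1) ^ q = (-1) ^ q := by
      rcases neg_one_pow_eq_or ℝ q with h | h <;> rw [h] <;> norm_num
    have e5 : a ^ (K - 1 - l) = a ^ K * a ^ l * a := by
      rw [e3, mul_assoc, sq_eq_one_of_sign ha, mul_one]
    rw [e, e2, mul_pow, ← one_div_mul_one_div, e4, e5]
    ring
  have B : ∑ l ∈ Finset.range L, a ^ (K + l) * (1 / (((K + l : ℕ) : ℝ) + 1 / 2 - K) ^ q) =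
      a ^ K * ∑ l ∈ Finset.range L, a ^ l / ((l : ℝ) + 1 / 2) ^ q := by
    rw [Finset.mul_sum]
    refine Finset.sum_congr rfl fun l _ => ?_
    rw [pow_add, mul_assoc, mul_one_div]
    congr 3
    push_cast
    ring
  rw [add_comm L K, Finset.sum_range_add, A, B]
  ring

/-- The symmetric double sum, with inner sum over `l` first, in terms of its inner limit. -/
theorem tendsto_sum_half_add_sub {a : ℝ} {p q : ℕ} (ha : a = 1 ∨ a = -1) (hq : 1 ≤ q)
    (haq : a = 1 → q ≠ 1) (hpq : a * (-1) ^ (p + q) = -1) (K : ℕ) :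
    Tendsto (fun L => ∑ l ∈ Finset.range L, a ^ l * (1 / ((K : ℝ) + ((l : ℝ) + 1 / 2)) ^ q +
        (-1) ^ p * (1 / ((l : ℝ) + 1 / 2 - K) ^ q))) atTop
      (𝓝 (2 * lerchPhi a q (K + 1 / 2) - (1 - (-1) ^ p) * a ^ K * lerchPhi a q (1 / 2))) := by
  have t1 := tendsto_sum_lerchPhi ha hq haq (α := K + 1 / 2) (by positivity)
  have t2 := (tendsto_sum_half_sub ha hq haq K).const_mul ((-1) ^ p)
  have e := pow_mul_lerchPhi_add ha hq haq (α := 1 / 2) (by norm_num) K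
  have hs := pow_mul_pow_of_sign ha K
  have : 2 * lerchPhi a q (K + 1 / 2) - (1 - (-1) ^ p) * a ^ K * lerchPhi a q (1 / 2) =
      lerchPhi a q (K + 1 / 2) + (-1) ^ p * (a ^ K * (lerchPhi a q (1 / 2) + (-1) ^ q * a *
        ∑ l ∈ Finset.range K, a ^ l / ((l : ℝ) + 1 / 2) ^ q)) := by
    -- By parity the reversed partial sum enters with coefficient -a^K. Being Φ(a, q, 1/2) - a^K
    -- Φ(a, q, K + 1/2), it supplies the second copy of Φ(a, q, K + 1/2).
    rw [pow_add] at hpq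
    linear_combination a ^ K * e - lerchPhi a q (K + 1 / 2) * hs -
      a ^ K * (∑ l ∈ Finset.range K, a ^ l / ((l : ℝ) + 1 / 2) ^ q) * hpq
  rw [this]
  refine (t1.add t2).congr fun L => ?_
  rw [Finset.mul_sum, ← Finset.sum_add_distrib]
  refine Finset.sum_congr rfl fun l _ => ?_
  rw [show (l : ℝ) + (K + 1 / 2) = K + (l + 1 / 2) by ring]
  ring

theorem sum_mul_symSum_eq {a b : ℝ} (hb : b = 1 ∨ b = -1) {n : ℕ} (hn : 1 ≤ n) (k e N T : ℕ) :
    ∑ l ∈ Finset.range (n * T),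
        a ^ l * (symSum b k (((l : ℝ) + 1 / 2) / n) N / ((l : ℝ) + 1 / 2) ^ e) =
      ∑ j ∈ Finset.range n, a ^ j / (n : ℝ) ^ e * ∑ t ∈ Finset.range T,
        (a ^ n * b) ^ t / ((t : ℝ) + (2 * j + 1) / (2 * n)) ^ e *
          (b ^ t * symSum b k ((t : ℝ) + (2 * j + 1) / (2 * n)) N) := by
  have hn0 : (n : ℝ) ≠ 0 := by positivity
  rw [sum_range_mul_eq]
  refine Finset.sum_congr rfl fun j _ => ?_
  rw [Finset.mul_sum]
  refine Finset.sum_congr rfl fun t _ => ?_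
  have e1 : ((n * t + j : ℕ) : ℝ) + 1 / 2 = n * ((t : ℝ) + (2 * j + 1) / (2 * n)) := by
    push_cast
    field_simp
    ring
  rw [e1, mul_div_cancel_left₀ _ hn0, mul_pow, mul_pow, pow_add, pow_mul]
  -- Inserting b^t b^t = 1 gives one b^t to the Lerch coefficient and one to the symmetric sum,
  -- which thereby becomes nearly constant in t.
  have := pow_mul_pow_of_sign hb t
  linear_combination (-(a ^ n) ^ t * a ^ j * symSum b k ((t : ℝ) + (2 * j + 1) / (2 * n)) N /
    ((n : ℝ) ^ e * ((t : ℝ) + (2 * j + 1) / (2 * n)) ^ e)) * this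

/-- The double sum with m summed first. The cutoff n T gives each residue class of l modulo n the
same number of terms. Since p + q - i ≥ q and p + q - k ≥ p, the conditions on q and p exclude every
divergent Lerch series. -/
theorem iterLim_symmetric_sum {a b : ℝ} {n p q : ℕ} (hn : 1 ≤ n) (hp : 1 ≤ p) (hq : 1 ≤ q)
    (ha : a = 1 ∨ a = -1) (hb : b = 1 ∨ b = -1)
    (hp1 : a ^ n * b = 1 → p ≠ 1) (hq1 : a = 1 → q ≠ 1) :
    IterLim (fun N T => ∑ l ∈ Finset.range (n * T), a ^ l *
        ∑ m ∈ Finset.range N, b ^ (m + 1) / ((m : ℝ) + 1) ^ p *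
          (1 / ((n : ℝ) * (m + 1) + ((l : ℝ) + 1 / 2)) ^ q +
            (-1) ^ p * (1 / (((l : ℝ) + 1 / 2) - (n : ℝ) * (m + 1)) ^ q)))
      ((n : ℝ) ^ p * (∑ i ∈ Finset.Icc 1 p,
          (-1) ^ (p - i) * ((p + q - i - 1).choose (q - 1) : ℝ) / (n : ℝ) ^ i *
            ((1 + (-1) ^ i) * (b * lerchPhi b i 1) * lerchPhi a (p + q - i) (1 / 2)) +
        (-1) ^ p * ∑ k ∈ Finset.Icc 1 q, ((p + q - k - 1).choose (p - 1) : ℝ) *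
            (1 / (n : ℝ) ^ k * ∑ j ∈ Finset.range n, a ^ j / (n : ℝ) ^ (p + q - k) *
              (lerchTheta b k (2 * j + 1) (2 * n) *
                lerchPhi (a ^ n * b) (p + q - k) ((2 * j + 1) / (2 * n))) +
              (-1) * lerchPhi a (p + q) (1 / 2)))) := by
  have hn0 : (0 : ℝ) < n := by exact_mod_cast hn
  have hc := sign_mul (sign_pow ha n) hb
  have hT : Tendsto (fun T : ℕ => n * T) atTop atTop :=
    tendsto_id.const_mul_atTop' (by omega)
  have φ : ∀ s, 1 ≤ s → (a = 1 → s ≠ 1) →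
      Tendsto (fun T => ∑ l ∈ Finset.range (n * T), a ^ l / ((l : ℝ) + 1 / 2) ^ s) atTop
        (𝓝 (lerchPhi a s (1 / 2))) := fun s h1 h2 =>
    (tendsto_sum_lerchPhi ha h1 h2 (by norm_num)).comp hT
  have hfun : (fun N T => ∑ l ∈ Finset.range (n * T), a ^ l *
        ∑ m ∈ Finset.range N, b ^ (m + 1) / ((m : ℝ) + 1) ^ p *
          (1 / ((n : ℝ) * (m + 1) + ((l : ℝ) + 1 / 2)) ^ q +
            (-1) ^ p * (1 / (((l : ℝ) + 1 / 2) - (n : ℝ) * (m + 1)) ^ q))) =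
      fun N T => (n : ℝ) ^ p * (∑ i ∈ Finset.Icc 1 p,
          (-1) ^ (p - i) * ((p + q - i - 1).choose (q - 1) : ℝ) / (n : ℝ) ^ i *
            (symZeta b i N * ∑ l ∈ Finset.range (n * T), a ^ l / ((l : ℝ) + 1 / 2) ^ (p + q - i)) +
        (-1) ^ p * ∑ k ∈ Finset.Icc 1 q, ((p + q - k - 1).choose (p - 1) : ℝ) *
            (1 / (n : ℝ) ^ k * ∑ j ∈ Finset.range n, a ^ j / (n : ℝ) ^ (p + q - k) *
              ∑ t ∈ Finset.range T,
                (a ^ n * b) ^ t / ((t : ℝ) + (2 * j + 1) / (2 * n)) ^ (p + q - k) *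
                  (b ^ t * symSum b k ((t : ℝ) + (2 * j + 1) / (2 * n)) N) +
              (-1) * ∑ l ∈ Finset.range (n * T), a ^ l / ((l : ℝ) + 1 / 2) ^ (p + q))) := by
    funext N T
    have hβ : ∀ l : ℕ, ∀ m : ℤ, (n : ℝ) * m + ((l : ℝ) + 1 / 2) ≠ 0 := by
      intro l m h
      have : ((2 * (n * m + l) + 1 : ℤ) : ℝ) = 0 := by push_cast; linarith
      have h2 : (2 * (n * m + l) + 1 : ℤ) = 0 := by exact_mod_cast this
      omega
    calc _ = ∑ l ∈ Finset.range (n * T), a ^ l * ((n : ℝ) ^ p * (∑ i ∈ Finset.Icc 1 p,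
            (-1) ^ (p - i) * ((p + q - i - 1).choose (q - 1) : ℝ) / (n : ℝ) ^ i * symZeta b i N *
              (1 / ((l : ℝ) + 1 / 2) ^ (p + q - i)) +
          (-1) ^ p * ∑ k ∈ Finset.Icc 1 q, ((p + q - k - 1).choose (p - 1) : ℝ) *
              (1 / (n : ℝ) ^ k * (symSum b k (((l : ℝ) + 1 / 2) / n) N /
                ((l : ℝ) + 1 / 2) ^ (p + q - k)) - 1 / ((l : ℝ) + 1 / 2) ^ (p + q)))) := by
          refine Finset.sum_congr rfl fun l _ => ?_
          rw [sum_symmetric_eq hn hp hq (hβ l)]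
      _ = _ := by
          simp only [← sum_mul_symSum_eq hb hn]
          simp only [Finset.mul_sum, mul_add, Finset.sum_add_distrib, mul_sub,
            Finset.sum_sub_distrib]
          rw [Finset.sum_comm, Finset.sum_comm (t := Finset.Icc 1 q),
            Finset.sum_comm (t := Finset.Icc 1 q), sub_eq_add_neg, ← Finset.sum_neg_distrib]
          simp only [← Finset.sum_neg_distrib]
          congr 1
          · refine Finset.sum_congr rfl fun i _ => Finset.sum_congr rfl fun l _ => ?_
            ring
          · congr 1 <;> refine Finset.sum_congr rfl fun i _ => Finset.sum_congr rfl fun l _ => ?_ <;>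
              ring
  rw [hfun]
  refine IterLim.const_mul _ (IterLim.add (IterLim.sum _ fun i hi => IterLim.const_mul _ ?_)
    (IterLim.const_mul _ (IterLim.sum _ fun k hk => IterLim.const_mul _ (IterLim.add
      (IterLim.const_mul _ (IterLim.sum _ fun j hj => IterLim.const_mul _ ?_))
      (IterLim.const_mul _ ?_)))))
  · rw [Finset.mem_Icc] at hi
    refine IterLim.mul_of_tendsto (tendsto_symZeta hb hi.1) (φ _ (by omega) fun h => ?_)
    have := hq1 h
    omega
  · rw [Finset.mem_Icc] at hk
    rw [Finset.mem_range] at hj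
    refine iterLim_symSum hb hc hk.1 (by omega) (fun h => ?_) (by positivity) ?_
    · have := hp1 h
      omega
    · have : (j : ℝ) + 1 ≤ n := by exact_mod_cast hj
      linarith
  · have := IterLim.mul_of_tendsto (tendsto_const_nhds (x := (1 : ℝ)) (f := atTop))
      (φ (p + q) (by omega) fun _ => by omega)
    simpa only [one_mul] using this

/-- Evaluation of the linear Euler type sum `S = ∑ m ≥ 1, b ^ m / m ^ p * Φ(a, q, n m + 1 / 2)`
when the parity condition `a = (-1) ^ (p + q - 1)` holds. -/
theorem euler_sum_eq {a b S : ℝ} {n p q : ℕ} (hn : 1 ≤ n) (hp : 1 ≤ p) (hq : 1 ≤ q)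
    (ha : a = 1 ∨ a = -1) (hb : b = 1 ∨ b = -1) (hpq : a * (-1) ^ (p + q) = -1)
    (hp1 : a ^ n * b = 1 → p ≠ 1) (hq1 : a = 1 → q ≠ 1)
    (hS : Tendsto (fun N => ∑ m ∈ Finset.range N, b ^ (m + 1) / ((m : ℝ) + 1) ^ p *
      lerchPhi a q (n * (m + 1) + 1 / 2)) atTop (𝓝 S)) :
    2 * S - (1 - (-1) ^ p) * lerchPhi a q (1 / 2) *
        (a ^ n * b * lerchPhi (a ^ n * b) p 1) =
      (n : ℝ) ^ p * (∑ i ∈ Finset.Icc 1 p,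
          (-1) ^ (p - i) * ((p + q - i - 1).choose (q - 1) : ℝ) / (n : ℝ) ^ i *
            ((1 + (-1) ^ i) * (b * lerchPhi b i 1) * lerchPhi a (p + q - i) (1 / 2)) +
        (-1) ^ p * ∑ k ∈ Finset.Icc 1 q, ((p + q - k - 1).choose (p - 1) : ℝ) *
            (1 / (n : ℝ) ^ k * ∑ j ∈ Finset.range n, a ^ j / (n : ℝ) ^ (p + q - k) *
              (lerchTheta b k (2 * j + 1) (2 * n) *
                lerchPhi (a ^ n * b) (p + q - k) ((2 * j + 1) / (2 * n))) +
              (-1) * lerchPhi a (p + q) (1 / 2))) := by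
  have hc := sign_mul (sign_pow ha n) hb
  have hT : Tendsto (fun T : ℕ => n * T) atTop atTop :=
    tendsto_id.const_mul_atTop' (by omega)
  -- The same truncated double sum with l summed first: `x N` is its limit in T at fixed N, and the
  -- limit of `x` is the left-hand side.
  refine (iterLim_symmetric_sum hn hp hq ha hb hp1 hq1).eq_of_tendsto
    (x := fun N => ∑ m ∈ Finset.range N, b ^ (m + 1) / ((m : ℝ) + 1) ^ p *
      (2 * lerchPhi a q (n * (m + 1) + 1 / 2) -
        (1 - (-1) ^ p) * a ^ (n * (m + 1)) * lerchPhi a q (1 / 2))) (fun N => ?_) ?_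
  · have h := tendsto_finsetSum (Finset.range N) fun m _ =>
      ((tendsto_sum_half_add_sub (p := p) ha hq hq1 hpq (n * (m + 1))).comp hT).const_mul
        (b ^ (m + 1) / ((m : ℝ) + 1) ^ p)
    push_cast at h
    refine h.congr fun T => ?_
    simp only [Function.comp_apply, Finset.mul_sum]
    rw [Finset.sum_comm]
    refine Finset.sum_congr rfl fun l _ => Finset.sum_congr rfl fun m _ => ?_
    ring
  · have h1 := (tendsto_sum_lerchPhi hc hp hp1 one_pos).const_mul (a ^ n * b)
    have h2 := (hS.const_mul 2).sub (h1.const_mul ((1 - (-1) ^ p) * lerchPhi a q (1 / 2)))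
    refine h2.congr fun N => ?_
    rw [Finset.mul_sum, Finset.mul_sum, Finset.mul_sum, ← Finset.sum_sub_distrib]
    refine Finset.sum_congr rfl fun m _ => ?_
    rw [pow_mul, mul_pow (a ^ n) b m, pow_succ b, pow_succ (a ^ n)]
    ring

/-! ### Integrals of powers of the logarithm on the unit interval -/

theorem ae_restrict_uIoc_of_forall_Ioo {P : ℝ → Prop} (h : ∀ x ∈ Set.Ioo (0 : ℝ) 1, P x) :
    ∀ᵐ x ∂(volume.restrict (Set.uIoc (0 : ℝ) 1)), P x := by
  rw [Set.uIoc_of_le zero_le_one, ← restrict_Ioo_eq_restrict_Ioc]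
  exact (ae_restrict_mem measurableSet_Ioo).mono h

theorem ae_mem_uIoc_imp_of_forall_Ioo {P : ℝ → Prop} (h : ∀ x ∈ Set.Ioo (0 : ℝ) 1, P x) :
    ∀ᵐ x : ℝ, x ∈ Set.uIoc (0 : ℝ) 1 → P x :=
  (ae_restrict_iff' measurableSet_uIoc).1 (ae_restrict_uIoc_of_forall_Ioo h)

theorem intervalIntegrable_of_abs_le_Ioo {f g : ℝ → ℝ} (hg : IntervalIntegrable g volume 0 1)
    (hf : Measurable f) (h : ∀ x ∈ Set.Ioo (0 : ℝ) 1, |f x| ≤ g x) :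
    IntervalIntegrable f volume 0 1 :=
  hg.mono_fun' hf.aestronglyMeasurable (ae_restrict_uIoc_of_forall_Ioo h)

theorem integral_congr_Ioo {f g : ℝ → ℝ} (h : ∀ x ∈ Set.Ioo (0 : ℝ) 1, f x = g x) :
    ∫ x in (0 : ℝ)..1, f x = ∫ x in (0 : ℝ)..1, g x :=
  intervalIntegral.integral_congr_ae (ae_mem_uIoc_imp_of_forall_Ioo h)

theorem intervalIntegrable_congr_Ioo {f g : ℝ → ℝ} (h : ∀ x ∈ Set.Ioo (0 : ℝ) 1, f x = g x)
    (hf : IntervalIntegrable f volume 0 1) : IntervalIntegrable g volume 0 1 :=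
  hf.congr_ae (ae_restrict_uIoc_of_forall_Ioo h)

/-- The exponent -1/2 serves two purposes: it is integrable at 0, and it is beaten by one factor x.
-/
theorem exists_abs_log_pow_le (k : ℕ) :
    ∃ C : ℝ, 0 ≤ C ∧ ∀ x : ℝ, 0 < x → x ≤ 1 → |Real.log x| ^ k ≤ C * x ^ (-(1 / 2) : ℝ) := by
  refine ⟨(2 * (k + 1 : ℝ)) ^ k, by positivity, fun x hx hx1 => ?_⟩
  rcases Nat.eq_zero_or_pos k with rfl | hk
  · simp only [pow_zero, one_mul]
    exact Real.one_le_rpow_of_pos_of_le_one_of_nonpos hx hx1 (by norm_num)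
  have hk0 : (0 : ℝ) < k := by exact_mod_cast hk
  have h := (Real.abs_log_mul_self_rpow_lt x (1 / (2 * k)) hx hx1 (by positivity)).le
  rw [one_div_one_div, abs_mul, abs_of_pos (Real.rpow_pos_of_pos hx _)] at h
  have h2 : |Real.log x| ^ k * x ^ (1 / 2 : ℝ) ≤ (2 * (k + 1 : ℝ)) ^ k := by
    have e : x ^ (1 / 2 : ℝ) = (x ^ (1 / (2 * k) : ℝ)) ^ k := by
      rw [← Real.rpow_natCast, ← Real.rpow_mul hx.le]
      congr 1
      field_simp
    rw [e, ← mul_pow]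
    refine pow_le_pow_left₀ (by positivity) (h.trans ?_) _
    linarith
  rw [Real.rpow_neg hx.le, ← div_eq_mul_inv, le_div_iff₀ (by positivity)]
  exact h2

theorem intervalIntegrable_abs_log_pow (k : ℕ) :
    IntervalIntegrable (fun x => |Real.log x| ^ k) volume 0 1 := by
  obtain ⟨C, -, hC⟩ := exists_abs_log_pow_le k
  refine intervalIntegrable_of_abs_le_Ioo
    ((intervalIntegral.intervalIntegrable_rpow' (r := -(1 / 2)) (by norm_num)).const_mul C)
    (by fun_prop) fun x hx => ?_
  rw [abs_of_nonneg (by positivity)]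
  exact hC x hx.1 hx.2.le

theorem intervalIntegrable_log_pow (k : ℕ) :
    IntervalIntegrable (fun x => Real.log x ^ k) volume 0 1 :=
  intervalIntegrable_of_abs_le_Ioo (intervalIntegrable_abs_log_pow k) (by fun_prop)
    fun x _ => (abs_pow _ _).le

theorem intervalIntegrable_pow_mul_log_pow (m k : ℕ) :
    IntervalIntegrable (fun x => x ^ m * Real.log x ^ k) volume 0 1 :=
  (intervalIntegrable_log_pow k).continuousOn_mul (by fun_prop)

/-- Supplies continuity at 0 for the fundamental theorem of calculus. The factor `0 ^ (m + 1)` makes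
the value there 0, which is also the limit. -/
theorem continuousOn_pow_mul_log_pow (m k : ℕ) :
    ContinuousOn (fun x : ℝ => x ^ (m + 1) * Real.log x ^ k) (Set.Icc 0 1) := by
  intro x hx
  rcases hx.1.eq_or_lt with rfl | h0
  · obtain ⟨C, hC0, hC⟩ := exists_abs_log_pow_le k
    have hz : (0 : ℝ) ^ (m + 1) * Real.log 0 ^ k = 0 := by simp
    rw [ContinuousWithinAt, hz]
    have hlim : Tendsto (fun x : ℝ => C * x ^ (1 / 2 : ℝ)) (𝓝[Set.Icc 0 1] 0) (𝓝 0) := by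
      have := ((Real.continuous_rpow_const (q := 1 / 2) (by norm_num)).const_mul C).tendsto 0
      rw [Real.zero_rpow (by norm_num), mul_zero] at this
      exact this.mono_left nhdsWithin_le_nhds
    refine squeeze_zero_norm' ?_ hlim
    filter_upwards [self_mem_nhdsWithin] with y hy
    rcases hy.1.eq_or_lt with rfl | hy0
    · simp
    · rw [Real.norm_eq_abs, abs_mul, abs_pow, abs_pow, abs_of_pos hy0]
      have h1 : y ^ (m + 1) ≤ y := pow_le_of_le_one hy.1 hy.2 (by omega)
      calc y ^ (m + 1) * |Real.log y| ^ k ≤ y * (C * y ^ (-(1 / 2) : ℝ)) :=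
            mul_le_mul h1 (hC y hy0 hy.2) (by positivity) hy.1
        _ = C * y ^ (1 / 2 : ℝ) := by
            rw [mul_left_comm, ← Real.rpow_one_add' hy.1 (by norm_num)]
            norm_num
  · have : ContinuousAt Real.log x := Real.continuousAt_log h0.ne'
    exact ((continuousAt_id.pow _).mul (this.pow _)).continuousWithinAt

/-- Integration by parts, as the derivative of x^{m+1} ln^{k+1} x. Both boundary values vanish, the
one at 0 by the power and the one at 1 by the logarithm. -/
theorem integral_pow_mul_log_pow (m k : ℕ) :
    ∫ x in (0 : ℝ)..1, x ^ m * Real.log x ^ k =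
      (-1) ^ k * (k.factorial : ℝ) / ((m : ℝ) + 1) ^ (k + 1) := by
  have hm : (m : ℝ) + 1 ≠ 0 := by positivity
  induction k with
  | zero =>
    simp [integral_pow]
  | succ k ih =>
    have hF := intervalIntegral.integral_eq_sub_of_hasDerivAt_of_le (zero_le_one (α := ℝ))
      (f := fun x => x ^ (m + 1) * Real.log x ^ (k + 1))
      (f' := fun x => ((m : ℝ) + 1) * (x ^ m * Real.log x ^ (k + 1)) +
        ((k : ℝ) + 1) * (x ^ m * Real.log x ^ k))
      (continuousOn_pow_mul_log_pow m (k + 1)) (fun x hx => by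
        have hx0 : x ≠ 0 := hx.1.ne'
        have := (hasDerivAt_pow (m + 1) x).mul ((Real.hasDerivAt_log hx0).pow (k + 1))
        refine this.congr_deriv ?_
        simp
        field_simp
        ring)
      (((intervalIntegrable_pow_mul_log_pow m (k + 1)).const_mul _).add
        ((intervalIntegrable_pow_mul_log_pow m k).const_mul _))
    rw [intervalIntegral.integral_add ((intervalIntegrable_pow_mul_log_pow m (k + 1)).const_mul _)
      ((intervalIntegrable_pow_mul_log_pow m k).const_mul _),
      intervalIntegral.integral_const_mul, intervalIntegral.integral_const_mul, ih] at hF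
    simp at hF
    rw [Nat.factorial_succ, pow_succ _ (k + 1), eq_div_iff (by positivity)]
    push_cast
    field_simp at hF ⊢
    linear_combination hF

/-! ### The logarithmic weight -/

/-- On [1/2, 1) the inequality ln x ≥ 1 - 1/x bounds the quotient by 2; on (0, 1/2) the denominator
exceeds 1/2. -/
theorem abs_log_div_one_sub_le {x : ℝ} (h0 : 0 < x) (h1 : x < 1) :
    |Real.log x| / (1 - x) ≤ 2 + 2 * |Real.log x| := by
  have hx : 0 < 1 - x := by linarith
  rw [div_le_iff₀ hx, abs_of_nonpos (Real.log_nonpos h0.le h1.le)]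
  have hl : Real.log x ≤ 0 := Real.log_nonpos h0.le h1.le
  rcases le_or_gt (1 / 2) x with h | h
  · have := Real.one_sub_inv_le_log_of_pos h0
    have h2 : x⁻¹ * (1 - x) ≤ 2 * (1 - x) := by
      have : x⁻¹ ≤ 2 := by
        rw [inv_le_comm₀ h0 (by norm_num)]; linarith
      gcongr
    have h3 : x⁻¹ * (1 - x) = x⁻¹ - 1 := by field_simp
    nlinarith
  · nlinarith

theorem one_sub_sign_mul_pow_pos {a x : ℝ} (ha : a = 1 ∨ a = -1) {d : ℕ} (hd : 1 ≤ d)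
    (h0 : 0 < x) (h1 : x < 1) : 0 < 1 - a * x ^ d := by
  have : x ^ d < 1 := pow_lt_one₀ h0.le h1 (by omega)
  have h2 : 0 < x ^ d := by positivity
  rcases ha with rfl | rfl <;> linarith

/-- An integrable bound for `ln ^ r x / (1 - a x ^ d)`. -/
noncomputable def logBound (r : ℕ) (x : ℝ) : ℝ :=
  if r = 0 then 1 else 2 * |Real.log x| ^ (r - 1) + 2 * |Real.log x| ^ r

theorem logBound_nonneg (r : ℕ) (x : ℝ) : 0 ≤ logBound r x := by
  rw [logBound]
  split_ifs <;> positivity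

/-- One logarithm cancels the simple pole at 1. Without a logarithm, a = -1 and the denominator is
at least 1. -/
theorem abs_log_pow_div_le {a x : ℝ} (ha : a = 1 ∨ a = -1) {r d : ℕ} (har : a = 1 → r ≠ 0)
    (hd : 1 ≤ d) (h0 : 0 < x) (h1 : x < 1) :
    |Real.log x ^ r / (1 - a * x ^ d)| ≤ logBound r x := by
  have hpos := one_sub_sign_mul_pow_pos ha hd h0 h1
  rw [abs_div, abs_pow, abs_of_pos hpos, logBound]
  have hd1 : x ^ d ≤ x := pow_le_of_le_one h0.le h1.le (by omega)
  have hd0 : 0 < x ^ d := by positivity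
  split_ifs with h
  · subst h
    have : a = -1 := ha.resolve_left fun h => har h rfl
    subst this
    rw [pow_zero, div_le_one hpos]
    linarith
  · obtain ⟨s, rfl⟩ := Nat.exists_eq_succ_of_ne_zero h
    have hle : 1 - x ≤ 1 - a * x ^ d := by
      rcases ha with rfl | rfl <;> linarith
    have hx : 0 < 1 - x := by linarith
    calc |Real.log x| ^ (s + 1) / (1 - a * x ^ d) ≤ |Real.log x| ^ (s + 1) / (1 - x) := by
          gcongr
      _ = |Real.log x| ^ s * (|Real.log x| / (1 - x)) := by ring
      _ ≤ |Real.log x| ^ s * (2 + 2 * |Real.log x|) := by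
          gcongr
          exact abs_log_div_one_sub_le h0 h1
      _ = _ := by
          simp only [Nat.succ_eq_add_one, Nat.add_sub_cancel]
          ring

theorem intervalIntegrable_logBound (r : ℕ) : IntervalIntegrable (logBound r) volume 0 1 := by
  unfold logBound
  split_ifs
  · exact intervalIntegrable_const
  · exact ((intervalIntegrable_abs_log_pow _).const_mul 2).add
      ((intervalIntegrable_abs_log_pow _).const_mul 2)

theorem intervalIntegrable_log_pow_div {a : ℝ} (ha : a = 1 ∨ a = -1) {r d : ℕ}
    (har : a = 1 → r ≠ 0) (hd : 1 ≤ d) :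
    IntervalIntegrable (fun x => Real.log x ^ r / (1 - a * x ^ d)) volume 0 1 :=
  intervalIntegrable_of_abs_le_Ioo (intervalIntegrable_logBound r) (by fun_prop)
    fun _ hx => abs_log_pow_div_le ha har hd hx.1 hx.2

theorem integral_pow_mul_abs_log_pow (m k : ℕ) :
    ∫ x in (0 : ℝ)..1, x ^ m * |Real.log x| ^ k = (k.factorial : ℝ) / ((m : ℝ) + 1) ^ (k + 1) := by
  have h : ∫ x in (0 : ℝ)..1, x ^ m * |Real.log x| ^ k =
      ∫ x in (0 : ℝ)..1, (-1) ^ k * (x ^ m * Real.log x ^ k) := by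
    refine integral_congr_Ioo fun x hx => ?_
    rw [abs_of_nonpos (Real.log_nonpos hx.1.le hx.2.le), neg_pow]
    ring
  rw [h, intervalIntegral.integral_const_mul, integral_pow_mul_log_pow, mul_div_assoc, ← mul_assoc,
    ← mul_pow]
  simp

/-- This decay in m makes the termwise integration absolutely convergent even for p = 1. -/
theorem exists_integral_pow_mul_logBound_le (r : ℕ) :
    ∃ C : ℝ, 0 ≤ C ∧ ∀ m : ℕ, ∫ x in (0 : ℝ)..1, x ^ m * logBound r x ≤ C / ((m : ℝ) + 1) := by
  rcases Nat.eq_zero_or_pos r with rfl | hr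
  · refine ⟨1, zero_le_one, fun m => ?_⟩
    simp [logBound, integral_pow]
  · obtain ⟨s, rfl⟩ := Nat.exists_eq_succ_of_ne_zero hr.ne'
    refine ⟨2 * (s.factorial : ℝ) + 2 * ((s + 1).factorial : ℝ), by positivity, fun m => ?_⟩
    have hi : ∀ k, IntervalIntegrable (fun x => x ^ m * |Real.log x| ^ k) volume 0 1 := fun k =>
      (intervalIntegrable_abs_log_pow k).continuousOn_mul (by fun_prop)
    have e : ∀ x, x ^ m * logBound (s + 1) x =
        2 * (x ^ m * |Real.log x| ^ s) + 2 * (x ^ m * |Real.log x| ^ (s + 1)) := by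
      intro x
      rw [logBound, if_neg (by omega)]
      simp only [Nat.add_sub_cancel]
      ring
    simp only [Nat.succ_eq_add_one, e]
    rw [intervalIntegral.integral_add ((hi s).const_mul 2) ((hi (s + 1)).const_mul 2),
      intervalIntegral.integral_const_mul, intervalIntegral.integral_const_mul,
      integral_pow_mul_abs_log_pow, integral_pow_mul_abs_log_pow, add_div, mul_div_assoc,
      mul_div_assoc]
    have hm : (1 : ℝ) ≤ (m : ℝ) + 1 := by linarith [(Nat.cast_nonneg m : (0 : ℝ) ≤ m)]
    gcongr
    · exact le_self_pow₀ hm (by omega)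
    · exact le_self_pow₀ hm (by omega)

/-- A finite geometric expansion whose remainder vanishes by dominated convergence. Absolute
summability is not available, since for a = -1 and r = 0 the resulting series converges only
conditionally. -/
theorem integral_pow_mul_log_pow_div {a : ℝ} (ha : a = 1 ∨ a = -1) {r d : ℕ}
    (har : a = 1 → r ≠ 0) (hd : 1 ≤ d) (K : ℕ) :
    ∫ x in (0 : ℝ)..1, x ^ K * (Real.log x ^ r / (1 - a * x ^ d)) =
      (-1) ^ r * (r.factorial : ℝ) / (d : ℝ) ^ (r + 1) * lerchPhi a (r + 1) (((K : ℝ) + 1) / d) := by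
  have hd0 : (0 : ℝ) < d := by exact_mod_cast hd
  have hw := intervalIntegrable_log_pow_div ha har hd
  have hKw : IntervalIntegrable (fun x => x ^ K * (Real.log x ^ r / (1 - a * x ^ d))) volume 0 1 :=
    hw.continuousOn_mul (by fun_prop)
  have hrem : Tendsto (fun L : ℕ => ∫ x in (0 : ℝ)..1,
      x ^ K * (Real.log x ^ r / (1 - a * x ^ d)) * (a * x ^ d) ^ L) atTop
      (𝓝 (∫ x in (0 : ℝ)..1, 0)) := by
    refine intervalIntegral.tendsto_integral_filter_of_dominated_convergence
      (fun x => |x ^ K * (Real.log x ^ r / (1 - a * x ^ d))|)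
      (Eventually.of_forall fun L => Measurable.aestronglyMeasurable (by fun_prop))
      (Eventually.of_forall fun L => ae_mem_uIoc_imp_of_forall_Ioo fun x hx => ?_) hKw.abs
      (ae_mem_uIoc_imp_of_forall_Ioo fun x hx => ?_)
    · rw [norm_mul, Real.norm_eq_abs]
      refine mul_le_of_le_one_right (abs_nonneg _) ?_
      rw [norm_pow]
      refine pow_le_one₀ (norm_nonneg _) ?_
      rw [norm_mul, norm_pow, Real.norm_eq_abs, Real.norm_eq_abs, abs_of_pos hx.1]
      have h1 : |a| = 1 := by rcases ha with rfl | rfl <;> simp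
      rw [h1, one_mul]
      exact pow_le_one₀ hx.1.le hx.2.le
    · have h1 : |a * x ^ d| < 1 := by
        have h1 : |a| = 1 := by rcases ha with rfl | rfl <;> simp
        rw [abs_mul, h1, one_mul, abs_pow, abs_of_pos hx.1]
        exact pow_lt_one₀ hx.1.le hx.2 (by omega)
      simpa using (tendsto_pow_atTop_nhds_zero_of_abs_lt_one h1).const_mul
        (x ^ K * (Real.log x ^ r / (1 - a * x ^ d)))
  have hfin : ∀ L : ℕ, ∑ l ∈ Finset.range L, a ^ l * ((-1) ^ r * (r.factorial : ℝ) /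
      (((K + d * l : ℕ) : ℝ) + 1) ^ (r + 1)) =
      (∫ x in (0 : ℝ)..1, x ^ K * (Real.log x ^ r / (1 - a * x ^ d))) -
        ∫ x in (0 : ℝ)..1, x ^ K * (Real.log x ^ r / (1 - a * x ^ d)) * (a * x ^ d) ^ L := by
    intro L
    have hi2 : IntervalIntegrable (fun x => x ^ K * (Real.log x ^ r / (1 - a * x ^ d)) *
        (a * x ^ d) ^ L) volume 0 1 := hKw.mul_continuousOn (by fun_prop)
    rw [← intervalIntegral.integral_sub hKw hi2]
    have : ∀ l, a ^ l * ((-1) ^ r * (r.factorial : ℝ) / (((K + d * l : ℕ) : ℝ) + 1) ^ (r + 1)) =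
        ∫ x in (0 : ℝ)..1, a ^ l * (x ^ (K + d * l) * Real.log x ^ r) := by
      intro l
      rw [intervalIntegral.integral_const_mul, integral_pow_mul_log_pow]
    simp only [this]
    rw [← intervalIntegral.integral_finsetSum fun l _ =>
      (intervalIntegrable_pow_mul_log_pow _ r).const_mul _]
    refine integral_congr_Ioo fun x hx => ?_
    have hpos := one_sub_sign_mul_pow_pos ha hd hx.1 hx.2
    have hgeo := geom_sum_mul_neg (a * x ^ d) L
    have e : ∑ l ∈ Finset.range L, a ^ l * (x ^ (K + d * l) * Real.log x ^ r) =
        x ^ K * Real.log x ^ r * ∑ l ∈ Finset.range L, (a * x ^ d) ^ l := by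
      rw [Finset.mul_sum]
      refine Finset.sum_congr rfl fun l _ => ?_
      rw [mul_pow, pow_add, pow_mul]
      ring
    rw [e]
    field_simp
    linear_combination x ^ K * Real.log x ^ r * hgeo
  have h1 := (tendsto_const_nhds (x := ∫ x in (0 : ℝ)..1,
    x ^ K * (Real.log x ^ r / (1 - a * x ^ d))) (f := atTop)).sub hrem
  rw [intervalIntegral.integral_zero, sub_zero] at h1
  have h2 := (tendsto_sum_lerchPhi ha (s := r + 1) (by omega) (fun h => by have := har h; omega)
    (α := ((K : ℝ) + 1) / d) (by positivity)).const_mul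
      ((-1) ^ r * (r.factorial : ℝ) / (d : ℝ) ^ (r + 1))
  refine tendsto_nhds_unique (h1.congr fun L => (hfin L).symm) (h2.congr fun L => ?_)
  rw [Finset.mul_sum]
  refine Finset.sum_congr rfl fun l _ => ?_
  have e : ((K + d * l : ℕ) : ℝ) + 1 = d * ((l : ℝ) + ((K : ℝ) + 1) / d) := by
    push_cast
    field_simp
    ring
  rw [e, mul_pow]
  field_simp

/-! ### Termwise integration -/

/-- Tonelli, for integrability of the sum itself: the absolute convergence of the integrals in the
theorem rests on it. -/
theorem integrable_of_hasSum {F : ℕ → ℝ → ℝ} {f : ℝ → ℝ} {μ : Measure ℝ}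
    (hF : ∀ m, Integrable (F m) μ) (hs : Summable fun m => ∫ x, ‖F m x‖ ∂μ)
    (hf : ∀ᵐ x ∂μ, HasSum (fun m => F m x) (f x)) : Integrable f μ := by
  refine ⟨aestronglyMeasurable_of_tendsto_ae atTop
    (f := fun N x => ∑ m ∈ Finset.range N, F m x) (fun N => ?_) ?_, ?_⟩
  · exact Finset.aestronglyMeasurable_fun_sum _ fun m _ => (hF m).1
  · filter_upwards [hf] with x hx using hx.tendsto_sum_nat
  · have h1 : ∫⁻ x, ‖f x‖ₑ ∂μ ≤ ∫⁻ x, ∑' m, ‖F m x‖ₑ ∂μ := by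
      refine lintegral_mono_ae ?_
      filter_upwards [hf] with x hx
      rw [← hx.tsum_eq]
      exact enorm_tsum_le_tsum_enorm
    have h2 : ∫⁻ x, ∑' m, ‖F m x‖ₑ ∂μ = ∑' m, ENNReal.ofReal (∫ x, ‖F m x‖ ∂μ) := by
      rw [lintegral_tsum fun m => (hF m).1.enorm]
      refine tsum_congr fun m => ?_
      rw [ofReal_integral_norm_eq_lintegral_enorm (hF m)]
    exact (h1.trans_eq h2).trans_lt (lt_top_iff_ne_top.2 hs.tsum_ofReal_ne_top)

theorem hasSum_intervalIntegral_zero_one {F : ℕ → ℝ → ℝ} {f : ℝ → ℝ} {u : ℕ → ℝ}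
    (hF : ∀ m, IntervalIntegrable (F m) volume 0 1) (hu : Summable u)
    (hFu : ∀ m, ∫ x in (0 : ℝ)..1, |F m x| ≤ u m)
    (hf : ∀ x ∈ Set.Ioo (0 : ℝ) 1, HasSum (fun m => F m x) (f x)) :
    IntervalIntegrable f volume 0 1 ∧
      HasSum (fun m => ∫ x in (0 : ℝ)..1, F m x) (∫ x in (0 : ℝ)..1, f x) := by
  have hae := ae_restrict_uIoc_of_forall_Ioo hf
  simp only [intervalIntegral.integral_of_le (zero_le_one (α := ℝ)),
    intervalIntegrable_iff_integrableOn_Ioc_of_le (zero_le_one (α := ℝ)),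
    Set.uIoc_of_le (zero_le_one (α := ℝ)), IntegrableOn] at *
  have hs : Summable fun m => ∫ x in Set.Ioc (0 : ℝ) 1, ‖F m x‖ :=
    Summable.of_nonneg_of_le (fun m => integral_nonneg fun x => norm_nonneg _) hFu hu
  refine ⟨integrable_of_hasSum hF hs hae, ?_⟩
  have h := hasSum_integral_of_summable_integral_norm hF hs
  rwa [integral_congr_ae (hae.mono fun x hx => hx.tsum_eq)] at h

/-! ### The power series of the polylogarithm -/

theorem hasSum_polylog {p : ℕ} (hp : 1 ≤ p) {x : ℝ} (hx : |x| < 1) :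
    HasSum (fun m : ℕ => x ^ (m + 1) / ((m : ℝ) + 1) ^ p) (polylog p x) := by
  obtain ⟨r, rfl⟩ := Nat.exists_eq_add_of_le' hp
  have hsum : Summable fun m : ℕ => |x| ^ (m + 1) * (r.factorial : ℝ) :=
    ((summable_geometric_of_lt_one (abs_nonneg x) hx).mul_right (|x| * (r.factorial : ℝ))).congr
      fun m => by rw [pow_succ]; ring
  have h := (hasSum_intervalIntegral_zero_one
    (F := fun m y => x ^ (m + 1) * (y ^ m * Real.log y ^ r))
    (f := polylogIntegrand (r + 1) x) (u := fun m => |x| ^ (m + 1) * (r.factorial : ℝ))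
    (fun m => (intervalIntegrable_pow_mul_log_pow m r).const_mul _) hsum (fun m => ?_)
    (fun y hy => ?_)).2
  · have h2 := h.mul_left ((-1) ^ r / (r.factorial : ℝ))
    rw [polylog, if_pos (abs_lt.1 hx).2.le]
    simp only [Nat.add_sub_cancel]
    refine h2.congr_fun fun m => ?_
    rw [intervalIntegral.integral_const_mul, integral_pow_mul_log_pow]
    have hs : ((-1 : ℝ) ^ r) * (-1) ^ r = 1 := by rw [← mul_pow]; norm_num
    have hr : (r.factorial : ℝ) ≠ 0 := by positivity
    field_simp
    rw [sq, hs, mul_one]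
  · have e : ∫ y in (0 : ℝ)..1, |x ^ (m + 1) * (y ^ m * Real.log y ^ r)| =
        ∫ y in (0 : ℝ)..1, |x| ^ (m + 1) * (y ^ m * |Real.log y| ^ r) := by
      refine integral_congr_Ioo fun y hy => ?_
      rw [abs_mul, abs_mul, abs_pow, abs_pow, abs_pow, abs_of_pos hy.1]
    rw [e, intervalIntegral.integral_const_mul, integral_pow_mul_abs_log_pow]
    refine mul_le_mul_of_nonneg_left (div_le_self (by positivity) ?_) (by positivity)
    exact one_le_pow₀ (by linarith [(Nat.cast_nonneg m : (0 : ℝ) ≤ m)])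
  · have hxy : |x * y| < 1 := by
      rw [abs_mul, abs_of_pos hy.1]
      exact (mul_le_of_le_one_right (abs_nonneg _) hy.2.le).trans_lt hx
    have h := (hasSum_geometric_of_abs_lt_one hxy).mul_left (x * Real.log y ^ r)
    rw [polylogIntegrand, div_eq_mul_inv]
    refine h.congr_fun fun m => ?_
    rw [mul_pow, pow_succ]
    ring

/-! ### The integral as an Euler sum -/

theorem integral_log_mul_polylog_eq {a b : ℝ} {n p q : ℕ} (hn : 1 ≤ n) (hp : 1 ≤ p) (hq : 1 ≤ q)
    (ha : a = 1 ∨ a = -1) (hb : b = 1 ∨ b = -1) (hq1 : a = 1 → q ≠ 1) :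
    IntervalIntegrable
        (fun x : ℝ => Real.log x ^ (q - 1) * polylog p (b * x ^ (2 * n)) / (1 - a * x ^ 2))
        volume 0 1 ∧
      ∃ S, Tendsto (fun N => ∑ m ∈ Finset.range N, b ^ (m + 1) / ((m : ℝ) + 1) ^ p *
          lerchPhi a q (n * (m + 1) + 1 / 2)) atTop (𝓝 S) ∧
        ∫ x in (0 : ℝ)..1,
          Real.log x ^ (q - 1) * polylog p (b * x ^ (2 * n)) / (1 - a * x ^ 2) =
          (-1) ^ (q - 1) * ((q - 1).factorial : ℝ) / 2 ^ q * S := by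
  have har : a = 1 → q - 1 ≠ 0 := fun h => by have := hq1 h; omega
  have hb1 : |b| = 1 := by rcases hb with rfl | rfl <;> simp
  obtain ⟨C, hC0, hC⟩ := exists_integral_pow_mul_logBound_le (q - 1)
  have hw := intervalIntegrable_log_pow_div ha har (d := 2) (by norm_num)
  have hpw : ∀ M : ℕ, IntervalIntegrable
      (fun x => x ^ M * (Real.log x ^ (q - 1) / (1 - a * x ^ 2))) volume 0 1 := fun M =>
    hw.continuousOn_mul (by fun_prop)
  -- One factor 1/(m + 1) comes from the polylogarithm coefficient, as p ≥ 1, and one from the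
  -- integrated weight.
  have hu : Summable fun m : ℕ => C * (1 / ((m : ℝ) + 1) ^ 2) := by
    refine Summable.mul_left C ?_
    have := (summable_nat_add_iff 1).2 (Real.summable_one_div_nat_pow.2 one_lt_two)
    exact_mod_cast this
  have key := hasSum_intervalIntegral_zero_one
    (F := fun m x => b ^ (m + 1) / ((m : ℝ) + 1) ^ p *
      (x ^ (2 * n * (m + 1)) * (Real.log x ^ (q - 1) / (1 - a * x ^ 2))))
    (f := fun x : ℝ => Real.log x ^ (q - 1) * polylog p (b * x ^ (2 * n)) / (1 - a * x ^ 2))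
    (fun m => (hpw _).const_mul _) hu (fun m => ?_) (fun x hx => ?_)
  · obtain ⟨h1, h2⟩ := key
    refine ⟨h1, (∑' m : ℕ, b ^ (m + 1) / ((m : ℝ) + 1) ^ p *
      lerchPhi a q (n * (m + 1) + 1 / 2)), ?_, ?_⟩
    all_goals
      have e : ∀ m : ℕ, ∫ x in (0 : ℝ)..1, b ^ (m + 1) / ((m : ℝ) + 1) ^ p *
          (x ^ (2 * n * (m + 1)) * (Real.log x ^ (q - 1) / (1 - a * x ^ 2))) =
          (-1) ^ (q - 1) * ((q - 1).factorial : ℝ) / 2 ^ q *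
            (b ^ (m + 1) / ((m : ℝ) + 1) ^ p * lerchPhi a q (n * (m + 1) + 1 / 2)) := by
        intro m
        rw [intervalIntegral.integral_const_mul, integral_pow_mul_log_pow_div ha har (by norm_num),
          Nat.sub_add_cancel hq]
        have : (((2 * n * (m + 1) : ℕ) : ℝ) + 1) / ((2 : ℕ) : ℝ) = n * (m + 1) + 1 / 2 := by
          push_cast
          ring
        rw [this]
        push_cast
        ring
      simp only [e] at h2
      have hk : (-1 : ℝ) ^ (q - 1) * ((q - 1).factorial : ℝ) / 2 ^ q ≠ 0 := by
        have : ((q - 1).factorial : ℝ) ≠ 0 := by positivity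
        positivity
    · exact ((summable_mul_left_iff hk).1 h2.summable).hasSum.tendsto_sum_nat
    · rw [← h2.tsum_eq, tsum_mul_left]
  · have hpos : (0 : ℝ) < (m : ℝ) + 1 := by positivity
    have hm1 : (1 : ℝ) ≤ (m : ℝ) + 1 := by linarith [(Nat.cast_nonneg m : (0 : ℝ) ≤ m)]
    calc ∫ x in (0 : ℝ)..1, |b ^ (m + 1) / ((m : ℝ) + 1) ^ p *
          (x ^ (2 * n * (m + 1)) * (Real.log x ^ (q - 1) / (1 - a * x ^ 2)))|
        = 1 / ((m : ℝ) + 1) ^ p * ∫ x in (0 : ℝ)..1,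
          |x ^ (2 * n * (m + 1)) * (Real.log x ^ (q - 1) / (1 - a * x ^ 2))| := by
          rw [← intervalIntegral.integral_const_mul]
          refine integral_congr_Ioo fun x _ => ?_
          rw [abs_mul, abs_div, abs_pow, hb1, one_pow, abs_of_pos (pow_pos hpos p)]
      _ ≤ 1 / ((m : ℝ) + 1) ^ p * ∫ x in (0 : ℝ)..1,
          x ^ (2 * n * (m + 1)) * logBound (q - 1) x := by
          refine mul_le_mul_of_nonneg_left ?_ (by positivity)
          refine intervalIntegral.integral_mono_ae_restrict zero_le_one (hpw _).abs
            ((intervalIntegrable_logBound _).continuousOn_mul (by fun_prop)) ?_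
          rw [← restrict_Ioo_eq_restrict_Icc]
          refine (ae_restrict_mem measurableSet_Ioo).mono fun x hx => ?_
          dsimp only
          rw [abs_mul, abs_of_pos (pow_pos hx.1 _)]
          exact mul_le_mul_of_nonneg_left
            (abs_log_pow_div_le ha har (by norm_num) hx.1 hx.2) (pow_nonneg hx.1.le _)
      _ ≤ 1 / ((m : ℝ) + 1) ^ 1 * (C / ((m : ℝ) + 1)) := by
          refine mul_le_mul ?_ ((hC _).trans ?_) ?_ (by positivity)
          · exact one_div_le_one_div_of_le (by positivity) (pow_le_pow_right₀ hm1 hp)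
          · have : (m : ℝ) ≤ ((2 * n * (m + 1) : ℕ) : ℝ) := by
              have : m ≤ 2 * n * (m + 1) := by nlinarith
              exact_mod_cast this
            gcongr
          · refine intervalIntegral.integral_nonneg zero_le_one fun x hx => ?_
            exact mul_nonneg (pow_nonneg hx.1 _) (logBound_nonneg _ _)
      _ = C * (1 / ((m : ℝ) + 1) ^ 2) := by
          field_simp
  · have hxn : x ^ (2 * n) < 1 := pow_lt_one₀ hx.1.le hx.2 (by omega)
    have hbx : |b * x ^ (2 * n)| < 1 := by
      rwa [abs_mul, hb1, one_mul, abs_of_pos (pow_pos hx.1 _)]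
    have h := (hasSum_polylog hp hbx).mul_left (Real.log x ^ (q - 1) / (1 - a * x ^ 2))
    have e : Real.log x ^ (q - 1) * polylog p (b * x ^ (2 * n)) / (1 - a * x ^ 2) =
        Real.log x ^ (q - 1) / (1 - a * x ^ 2) * polylog p (b * x ^ (2 * n)) := by ring
    rw [e]
    refine h.congr_fun fun m => ?_
    rw [mul_pow, ← pow_mul]
    ring

/-! ### The inversion formula for the polylogarithm -/

theorem intervalIntegrable_fun_sum {ι : Type*} {s : Finset ι} {f : ι → ℝ → ℝ} {c d : ℝ}
    (h : ∀ i ∈ s, IntervalIntegrable (f i) volume c d) :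
    IntervalIntegrable (fun x => ∑ i ∈ s, f i x) volume c d := by
  have := IntervalIntegrable.sum s h
  simpa only [Finset.sum_fn] using this

theorem intervalIntegrable_add_mul_log_pow (L σ : ℝ) (r : ℕ) :
    IntervalIntegrable (fun w => (L + σ * Real.log w) ^ r) volume 0 1 := by
  have e : (fun w => (L + σ * Real.log w) ^ r) = fun w => ∑ i ∈ Finset.range (r + 1),
      (L ^ i * σ ^ (r - i) * (r.choose i : ℝ)) * Real.log w ^ (r - i) := by
    funext w
    rw [add_pow]
    refine Finset.sum_congr rfl fun i _ => ?_
    rw [mul_pow]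
    ring
  rw [e]
  exact intervalIntegrable_fun_sum fun i _ => (intervalIntegrable_log_pow _).const_mul _

/-- The integrand of the polylogarithm after the substitutions `y = X v` and `y = X / w`. -/
noncomputable def logKernel (b L σ : ℝ) (r : ℕ) (v : ℝ) : ℝ :=
  (L + σ * Real.log v) ^ r * (b / (1 - b * v))

theorem one_sub_le_one_sub_sign_mul {b v : ℝ} (hb : b = 1 ∨ b = -1) (hv : 0 ≤ v) :
    1 - v ≤ 1 - b * v := by
  rcases hb with rfl | rfl <;> linarith

theorem intervalIntegrable_logKernel {b z : ℝ} (hb : b = 1 ∨ b = -1) (L σ : ℝ) (r : ℕ)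
    (hz0 : 0 ≤ z) (hz1 : z < 1) : IntervalIntegrable (logKernel b L σ r) volume 0 z := by
  unfold logKernel
  refine IntervalIntegrable.mul_continuousOn ?_ ?_
  · refine (intervalIntegrable_add_mul_log_pow L σ r).mono_set ?_
    rw [Set.uIcc_of_le hz0, Set.uIcc_of_le zero_le_one]
    exact Set.Icc_subset_Icc_right hz1.le
  · rw [Set.uIcc_of_le hz0]
    refine continuousOn_const.div (by fun_prop) fun v hv => ?_
    have := one_sub_le_one_sub_sign_mul hb hv.1
    have := hv.2
    exact ne_of_gt (by linarith)

theorem polylogIntegrand_eq_logKernel {b X v : ℝ} (hX : 0 < X) (hv : 0 < v) (p : ℕ) :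
    X * polylogIntegrand p (b * X⁻¹) (X * v) = logKernel b (Real.log X) 1 (p - 1) v := by
  rw [polylogIntegrand, logKernel, Real.log_mul hX.ne' hv.ne']
  have : b * X⁻¹ * (X * v) = b * v := by field_simp
  rw [this, one_mul]
  field_simp

/-- The substitution y = X/w folds the part beyond the pole onto (X, 1). As b² = 1, the kernel b/(1
- bw) reappears, with the sign of the logarithm reversed and an extra 1/w that produces the pure
power of ln X. -/
theorem polylogIntegrand_div_eq_logKernel {b X w : ℝ} (hb : b = 1 ∨ b = -1) (hX : 0 < X)
    (hw : 0 < w) (hw1 : w < 1) (p : ℕ) :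
    polylogIntegrand p (b * X⁻¹) (X / w) * (-X / w ^ 2) =
      logKernel b (Real.log X) (-1) (p - 1) w +
        (Real.log X + (-1) * Real.log w) ^ (p - 1) / w := by
  rw [polylogIntegrand, logKernel, Real.log_div hX.ne' hw.ne', neg_one_mul, ← sub_eq_add_neg]
  have e : b * X⁻¹ * (X / w) = b / w := by field_simp
  rw [e]
  have h1 := one_sub_le_one_sub_sign_mul hb hw.le
  have h2 : 1 - b * w ≠ 0 := ne_of_gt (by linarith)
  have h3 : w - b ≠ 0 := by
    rcases hb with rfl | rfl
    · exact ne_of_lt (by linarith)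
    · exact ne_of_gt (by linarith)
  have h4 : 1 - b / w ≠ 0 := by
    rw [one_sub_div hw.ne']
    exact div_ne_zero h3 hw.ne'
  have hbb := sq_eq_one_of_sign hb
  have key : b * X⁻¹ / (1 - b / w) * (-X / w ^ 2) = b / (1 - b * w) + 1 / w := by
    rw [one_sub_div hw.ne']
    field_simp
    linear_combination w * hbb
  calc b * X⁻¹ * (Real.log X - Real.log w) ^ (p - 1) / (1 - b / w) * (-X / w ^ 2)
      = (Real.log X - Real.log w) ^ (p - 1) * (b * X⁻¹ / (1 - b / w) * (-X / w ^ 2)) := by ring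
    _ = _ := by rw [key]; ring

theorem integral_sub_log_pow_div {X z : ℝ} (hX : 0 < X) (hz : 0 < z) (r : ℕ) :
    ∫ w in X..z, (Real.log X + (-1) * Real.log w) ^ r / w =
      -(Real.log X - Real.log z) ^ (r + 1) / ((r : ℝ) + 1) := by
  have hpos : ∀ w ∈ Set.uIcc X z, 0 < w := fun w hw =>
    (lt_min hX hz).trans_le (Set.mem_uIcc.1 hw |>.elim (fun h => (min_le_left _ _).trans h.1)
      fun h => (min_le_right _ _).trans h.1)
  have hr : (r : ℝ) + 1 ≠ 0 := by positivity
  rw [intervalIntegral.integral_eq_sub_of_hasDerivAt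
    (f := fun w => -(Real.log X - Real.log w) ^ (r + 1) / ((r : ℝ) + 1))]
  · simp
  · intro w hw
    have h := (((Real.hasDerivAt_log (hpos w hw).ne').const_sub (Real.log X)).fun_pow
      (r + 1)).neg.div_const ((r : ℝ) + 1)
    refine h.congr_deriv ?_
    have := (hpos w hw).ne'
    push_cast
    rw [show Real.log X + -1 * Real.log w = Real.log X - Real.log w by ring]
    field_simp
  · refine ContinuousOn.intervalIntegrable ?_
    refine ContinuousOn.div ?_ continuousOn_id fun w hw => (hpos w hw).ne'
    refine ContinuousOn.pow (continuousOn_const.add (continuousOn_const.mul ?_)) _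
    exact Real.continuousOn_log.mono fun w hw => (hpos w hw).ne'

theorem intervalIntegrable_polylogIntegrand_left {b X z : ℝ} (hb : b = 1 ∨ b = -1) (hX : 0 < X)
    (p : ℕ) (hz0 : 0 ≤ z) (hz1 : z ≤ 1) (hz : b = 1 → z < X) :
    IntervalIntegrable (polylogIntegrand p (b * X⁻¹)) volume 0 z := by
  have e : polylogIntegrand p (b * X⁻¹) = fun y =>
      Real.log y ^ (p - 1) * (b * X⁻¹ / (1 - b * X⁻¹ * y)) := by
    funext y
    rw [polylogIntegrand]
    ring
  rw [e]
  refine IntervalIntegrable.mul_continuousOn ?_ ?_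
  · refine (intervalIntegrable_log_pow (p - 1)).mono_set ?_
    rw [Set.uIcc_of_le hz0, Set.uIcc_of_le zero_le_one]
    exact Set.Icc_subset_Icc_right hz1
  · rw [Set.uIcc_of_le hz0]
    refine continuousOn_const.div (by fun_prop) fun y hy => ne_of_gt ?_
    rcases hb with rfl | rfl
    · have : X⁻¹ * y < 1 := by
        rw [inv_mul_lt_one₀ hX]
        exact hy.2.trans_lt (hz rfl)
      linarith
    · have : 0 ≤ X⁻¹ * y := mul_nonneg (inv_nonneg.2 hX.le) hy.1
      linarith

theorem continuousOn_polylogIntegrand_right {b X : ℝ} (hb : b = 1 ∨ b = -1) (hX : 0 < X)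
    (p : ℕ) : ContinuousOn (polylogIntegrand p (b * X⁻¹)) (Set.Ioi X) := by
  unfold polylogIntegrand
  refine ContinuousOn.div ?_ (by fun_prop) fun y hy => ?_
  · refine continuousOn_const.mul (ContinuousOn.pow ?_ _)
    exact Real.continuousOn_log.mono fun y hy => (hX.trans hy).ne'
  · have h1 : 1 < X⁻¹ * y := by
      rw [← div_eq_inv_mul, one_lt_div hX]
      exact hy
    rcases hb with rfl | rfl
    · exact ne_of_lt (by linarith)
    · exact ne_of_gt (by linarith)

theorem integral_polylogIntegrand_left {b X δ : ℝ} (hX : 0 < X) (hδ1 : δ < 1) (p : ℕ) :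
    ∫ y in (0 : ℝ)..(X - X * δ), polylogIntegrand p (b * X⁻¹) y =
      ∫ v in (0 : ℝ)..(1 - δ), logKernel b (Real.log X) 1 (p - 1) v := by
  have h := intervalIntegral.mul_integral_comp_mul_left (a := 0) (b := 1 - δ)
    (f := polylogIntegrand p (b * X⁻¹)) X
  rw [mul_zero, mul_sub, mul_one] at h
  rw [← h, ← intervalIntegral.integral_const_mul]
  refine intervalIntegral.integral_congr_ae (Eventually.of_forall fun v hv => ?_)
  rw [Set.uIoc_of_le (by linarith)] at hv
  exact polylogIntegrand_eq_logKernel hX hv.1 p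

/-- Under y = X/w the cutoff X(1 + δ) goes to 1/(1 + δ), whereas y = Xv sends X(1 - δ) to 1 - δ. The
two upper limits differ by O(δ²). -/
theorem integral_polylogIntegrand_right {b X δ : ℝ} (hb : b = 1 ∨ b = -1) (hX : 0 < X)
    (hδ0 : 0 < δ) (hδX : X * (1 + δ) < 1) (p : ℕ) :
    ∫ y in (X + X * δ)..1, polylogIntegrand p (b * X⁻¹) y =
      -(∫ w in X..(1 + δ)⁻¹, logKernel b (Real.log X) (-1) (p - 1) w) +
        (Real.log X + Real.log (1 + δ)) ^ (p - 1 + 1) / (((p - 1 : ℕ) : ℝ) + 1) := by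
  have hd : 0 < 1 + δ := by linarith
  have hXz : X ≤ (1 + δ)⁻¹ := by
    rw [le_inv_comm₀ hX hd, ← one_div, le_div_iff₀ hX]
    linarith
  have hz1 : (1 + δ)⁻¹ < 1 := inv_lt_one_of_one_lt₀ (by linarith)
  have hz0 : 0 < (1 + δ)⁻¹ := by positivity
  have hsub := intervalIntegral.integral_comp_mul_deriv' (a := X) (b := (1 + δ)⁻¹)
    (f := fun w => X / w) (f' := fun w => -X / w ^ 2) (g := polylogIntegrand p (b * X⁻¹))
    (fun w hw => by
      rw [Set.uIcc_of_le hXz] at hw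
      have hw0 : w ≠ 0 := (hX.trans_le hw.1).ne'
      have := (hasDerivAt_inv hw0).const_mul X
      simp only [div_eq_mul_inv]
      exact this.congr_deriv (by ring))
    (by
      rw [Set.uIcc_of_le hXz]
      exact continuousOn_const.div (by fun_prop) fun w hw => pow_ne_zero _ (hX.trans_le hw.1).ne')
    (by
      refine (continuousOn_polylogIntegrand_right hb hX p).mono ?_
      rintro _ ⟨w, hw, rfl⟩
      rw [Set.uIcc_of_le hXz] at hw
      have hw0 : 0 < w := hX.trans_le hw.1
      rw [Set.mem_Ioi, lt_div_iff₀ hw0]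
      have := hw.2.trans_lt hz1
      nlinarith)
  rw [div_self hX.ne', div_inv_eq_mul, mul_add, mul_one] at hsub
  rw [intervalIntegral.integral_symm, ← hsub]
  have hcongr : ∫ w in X..(1 + δ)⁻¹,
      (polylogIntegrand p (b * X⁻¹) ∘ fun w => X / w) w * (-X / w ^ 2) =
      ∫ w in X..(1 + δ)⁻¹, (logKernel b (Real.log X) (-1) (p - 1) w +
        (Real.log X + (-1) * Real.log w) ^ (p - 1) / w) := by
    refine intervalIntegral.integral_congr fun w hw => ?_
    rw [Set.uIcc_of_le hXz] at hw
    exact polylogIntegrand_div_eq_logKernel hb hX (hX.trans_le hw.1) (hw.2.trans_lt hz1) p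
  have hi1 : IntervalIntegrable (logKernel b (Real.log X) (-1) (p - 1)) volume X (1 + δ)⁻¹ := by
    refine (intervalIntegrable_logKernel hb _ _ _ hz0.le hz1).mono_set ?_
    rw [Set.uIcc_of_le hXz, Set.uIcc_of_le hz0.le]
    exact Set.Icc_subset_Icc_left hX.le
  have hi2 : IntervalIntegrable (fun w => (Real.log X + (-1) * Real.log w) ^ (p - 1) / w)
      volume X (1 + δ)⁻¹ := by
    refine ContinuousOn.intervalIntegrable ?_
    rw [Set.uIcc_of_le hXz]
    refine ContinuousOn.div ?_ continuousOn_id fun w hw => (hX.trans_le hw.1).ne'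
    refine ContinuousOn.pow (continuousOn_const.add (continuousOn_const.mul ?_)) _
    exact Real.continuousOn_log.mono fun w hw => (hX.trans_le hw.1).ne'
  rw [hcongr, intervalIntegral.integral_add hi1 hi2, integral_sub_log_pow_div hX hz0,
    Real.log_inv, sub_neg_eq_add]
  ring

theorem integral_logKernel_neg {b X : ℝ} (hX : 0 < X) (p : ℕ) :
    ∫ w in (0 : ℝ)..X, logKernel b (Real.log X) (-1) (p - 1) w =
      (-1) ^ (p - 1) * ∫ y in (0 : ℝ)..1, polylogIntegrand p (b * X) y := by
  have h := intervalIntegral.mul_integral_comp_mul_left (a := 0) (b := 1)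
    (f := logKernel b (Real.log X) (-1) (p - 1)) X
  rw [mul_zero, mul_one] at h
  rw [← h, ← intervalIntegral.integral_const_mul, ← intervalIntegral.integral_const_mul]
  refine integral_congr_Ioo fun y hy => ?_
  rw [logKernel, polylogIntegrand, Real.log_mul hX.ne' hy.1.ne']
  have : Real.log X + -1 * (Real.log X + Real.log y) = (-1) * Real.log y := by ring
  rw [this, mul_pow, mul_assoc b X y]
  ring

/-- Even powers of ln v cancel in the difference, so each surviving term has a zero at v = 1 against
the pole. This is why the principal value exists. -/
theorem logKernel_sub_eq {b L v : ℝ} (r : ℕ) :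
    logKernel b L 1 r v - logKernel b L (-1) r v =
      ∑ i ∈ Finset.range (r + 1), (r.choose i : ℝ) * L ^ (r - i) * (1 - (-1) ^ i) * b *
        (Real.log v ^ i / (1 - b * v ^ 1)) := by
  rw [logKernel, logKernel, add_comm L, add_comm L, add_pow, add_pow, Finset.sum_mul,
    Finset.sum_mul, ← Finset.sum_sub_distrib]
  refine Finset.sum_congr rfl fun i _ => ?_
  rw [mul_pow, mul_pow]
  ring

theorem intervalIntegrable_term_logKernel_sub {b : ℝ} (hb : b = 1 ∨ b = -1) (C : ℝ) (i : ℕ) :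
    IntervalIntegrable (fun v => C * (1 - (-1) ^ i) * b * (Real.log v ^ i / (1 - b * v ^ 1)))
      volume 0 1 := by
  rcases Nat.eq_zero_or_pos i with rfl | hi
  · simp
  · exact (intervalIntegrable_log_pow_div hb (fun _ => hi.ne') le_rfl).const_mul _

theorem integral_logKernel_sub {b : ℝ} (hb : b = 1 ∨ b = -1) (L : ℝ) (r : ℕ) :
    IntervalIntegrable (fun v => logKernel b L 1 r v - logKernel b L (-1) r v) volume 0 1 ∧
    ∫ v in (0 : ℝ)..1, (logKernel b L 1 r v - logKernel b L (-1) r v) =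
      ∑ i ∈ Finset.range (r + 1), (r.choose i : ℝ) * L ^ (r - i) * (1 - (-1) ^ i) * b *
        ((-1) ^ i * (i.factorial : ℝ) * lerchPhi b (i + 1) 1) := by
  simp only [logKernel_sub_eq]
  refine ⟨intervalIntegrable_fun_sum fun i _ => intervalIntegrable_term_logKernel_sub hb _ i, ?_⟩
  rw [intervalIntegral.integral_finsetSum fun i _ => intervalIntegrable_term_logKernel_sub hb _ i]
  refine Finset.sum_congr rfl fun i _ => ?_
  rw [intervalIntegral.integral_const_mul]
  rcases Nat.eq_zero_or_pos i with rfl | hi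
  · simp
  · have h := integral_pow_mul_log_pow_div hb (r := i) (fun _ => hi.ne') le_rfl 0
    simp only [pow_zero, one_mul] at h
    rw [h]
    simp

/-- The interval has length δ²/(1 + δ) and the kernel is O(1/δ) on it, so the mismatch of the two
cutoffs disappears in the limit. -/
theorem abs_integral_logKernel_le {b L δ : ℝ} (hb : b = 1 ∨ b = -1) (hδ0 : 0 < δ)
    (hδ1 : δ ≤ 1 / 2) (r : ℕ) :
    |∫ w in (1 - δ)..(1 + δ)⁻¹, logKernel b L (-1) r w| ≤ (|L| + 1) ^ r * δ := by
  have hd : 0 < 1 + δ := by linarith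
  have hle : 1 - δ ≤ (1 + δ)⁻¹ := by
    rw [le_inv_comm₀ (by linarith) hd, ← one_div, le_div_iff₀ (by linarith)]
    nlinarith
  have h := intervalIntegral.norm_integral_le_of_norm_le_const (a := 1 - δ) (b := (1 + δ)⁻¹)
    (f := logKernel b L (-1) r) (C := (|L| + 1) ^ r * ((1 + δ) / δ)) fun w hw => ?_
  · have e : (1 + δ)⁻¹ - (1 - δ) = δ ^ 2 / (1 + δ) := by field_simp; ring
    rw [Real.norm_eq_abs, e, abs_of_pos (show 0 < δ ^ 2 / (1 + δ) by positivity)] at h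
    refine h.trans_eq ?_
    field_simp
  · rw [Set.uIoc_of_le hle] at hw
    have hw0 : 1 / 2 < w := by linarith [hw.1]
    have hz : (1 + δ)⁻¹ = 1 - δ / (1 + δ) := by field_simp; ring
    have hwz : δ / (1 + δ) ≤ 1 - w := by linarith [hw.2]
    have hpos : 0 < δ / (1 + δ) := by positivity
    have hlog : |Real.log w| ≤ 1 := by
      rw [abs_of_nonpos (Real.log_nonpos (by linarith) (by linarith))]
      have h1 := Real.one_sub_inv_le_log_of_pos (show 0 < w by linarith)
      have h2 : w⁻¹ ≤ 2 := by rw [inv_le_comm₀ (by linarith) (by norm_num)]; linarith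
      linarith
    have hden := one_sub_le_one_sub_sign_mul hb (show 0 ≤ w by linarith)
    have hb1 : |b| = 1 := by rcases hb with rfl | rfl <;> simp
    rw [Real.norm_eq_abs, logKernel, abs_mul, abs_pow, abs_div, hb1,
      abs_of_pos (show 0 < 1 - b * w by linarith)]
    refine mul_le_mul (pow_le_pow_left₀ (abs_nonneg _) ?_ _) ?_ (by
      have : 0 < 1 - b * w := by linarith
      positivity) (by positivity)
    · refine (abs_add_le _ _).trans ?_
      rw [abs_mul, abs_neg, abs_one, one_mul]
      linarith
    · have := one_div_le_one_div_of_le hpos (hwz.trans hden)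
      rwa [one_div_div] at this

/-- The value of the (principal value) integral that defines `Li_p (b / X)`. -/
noncomputable def inversionValue (p : ℕ) (b X : ℝ) : ℝ :=
  (-1) ^ (p - 1) * (∫ y in (0 : ℝ)..1, polylogIntegrand p (b * X) y) +
    (∑ i ∈ Finset.range (p - 1 + 1), ((p - 1).choose i : ℝ) * Real.log X ^ (p - 1 - i) *
      (1 - (-1) ^ i) * b * ((-1) ^ i * (i.factorial : ℝ) * lerchPhi b (i + 1) 1)) +
    Real.log X ^ (p - 1 + 1) / (((p - 1 : ℕ) : ℝ) + 1)

/-- With the cutoff Xδ, the two pieces combine into ∫_0^{1-δ} (f - g) + ∫_0^X g - ∫_{1-δ}^{1/(1+δ)}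
g and a logarithmic term. The first is integrable up to 1, the second gives Li_p(bX), and the third
vanishes. -/
theorem tendsto_cutoff_scaled {b X : ℝ} (hb : b = 1 ∨ b = -1) (hX : 0 < X) (hX1 : X < 1) (p : ℕ) :
    Tendsto (fun δ : ℝ => (∫ y in (0 : ℝ)..(X - X * δ), polylogIntegrand p (b * X⁻¹) y) +
      ∫ y in (X + X * δ)..1, polylogIntegrand p (b * X⁻¹) y) (𝓝[>] 0)
      (𝓝 (inversionValue p b X)) := by
  set f := logKernel b (Real.log X) 1 (p - 1) with hf
  set g := logKernel b (Real.log X) (-1) (p - 1) with hg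
  obtain ⟨hDi, hD⟩ := integral_logKernel_sub hb (Real.log X) (p - 1)
  have hsmall : ∀ᶠ δ : ℝ in 𝓝[>] 0, 0 < δ ∧ δ ≤ 1 / 2 ∧ X * (1 + δ) < 1 := by
    refine (eventually_mem_nhdsWithin).and (Eventually.filter_mono nhdsWithin_le_nhds ?_)
    refine (eventually_le_nhds (by norm_num)).and ?_
    have : Tendsto (fun δ : ℝ => X * (1 + δ)) (𝓝 0) (𝓝 (X * (1 + 0))) :=
      Continuous.tendsto (by fun_prop) 0
    exact this.eventually_lt_const (by simpa using hX1)
  have t1 : Tendsto (fun δ : ℝ => ∫ v in (0 : ℝ)..(1 - δ), (f v - g v)) (𝓝[>] 0)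
      (𝓝 (∫ v in (0 : ℝ)..1, (f v - g v))) := by
    have hc := intervalIntegral.continuousOn_primitive_interval (a := (0 : ℝ)) (b := 1)
      (f := fun v => f v - g v) (μ := volume) (by
        rw [Set.uIcc_of_le zero_le_one, integrableOn_Icc_iff_integrableOn_Ioc]
        exact (intervalIntegrable_iff_integrableOn_Ioc_of_le zero_le_one).1 hDi)
    have h1 := hc 1 Set.right_mem_uIcc
    refine Tendsto.comp (y := 𝓝[Set.uIcc 0 1] 1) h1 (tendsto_nhdsWithin_iff.2 ⟨?_, ?_⟩)
    · have : Tendsto (fun δ : ℝ => 1 - δ) (𝓝 0) (𝓝 (1 - 0)) := Continuous.tendsto (by fun_prop) 0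
      rw [sub_zero] at this
      exact this.mono_left nhdsWithin_le_nhds
    · filter_upwards [hsmall] with δ hδ
      rw [Set.uIcc_of_le zero_le_one]
      exact ⟨by linarith, by linarith⟩
  have t2 : Tendsto (fun δ : ℝ => ∫ w in (1 - δ)..(1 + δ)⁻¹, g w) (𝓝[>] 0) (𝓝 0) := by
    have hlim : Tendsto (fun δ : ℝ => (|Real.log X| + 1) ^ (p - 1) * δ) (𝓝[>] 0) (𝓝 0) := by
      have : Tendsto (fun δ : ℝ => (|Real.log X| + 1) ^ (p - 1) * δ) (𝓝 0)
        (𝓝 ((|Real.log X| + 1) ^ (p - 1) * 0)) := Continuous.tendsto (by fun_prop) 0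
      rw [mul_zero] at this
      exact this.mono_left nhdsWithin_le_nhds
    refine squeeze_zero_norm' ?_ hlim
    filter_upwards [hsmall] with δ hδ
    exact abs_integral_logKernel_le hb hδ.1 hδ.2.1 _
  have t3 : Tendsto (fun δ : ℝ => (Real.log X + Real.log (1 + δ)) ^ (p - 1 + 1) /
      (((p - 1 : ℕ) : ℝ) + 1)) (𝓝[>] 0)
      (𝓝 (Real.log X ^ (p - 1 + 1) / (((p - 1 : ℕ) : ℝ) + 1))) := by
    have hc : ContinuousAt (fun δ : ℝ => (Real.log X + Real.log (1 + δ)) ^ (p - 1 + 1) /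
        (((p - 1 : ℕ) : ℝ) + 1)) 0 := by
      refine ContinuousAt.div_const (ContinuousAt.pow (continuousAt_const.add ?_) _) _
      exact ContinuousAt.log (by fun_prop) (by norm_num)
    have := hc.tendsto
    simp only [add_zero, Real.log_one] at this
    exact this.mono_left nhdsWithin_le_nhds
  have t4 := ((t1.add (tendsto_const_nhds (x := ∫ w in (0 : ℝ)..X, g w))).sub t2).add t3
  rw [hD, integral_logKernel_neg hX, sub_zero] at t4
  rw [inversionValue, add_comm ((-1) ^ (p - 1) * _)]
  refine t4.congr' ?_
  filter_upwards [hsmall] with δ ⟨h0, h1, h2⟩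
  have hz0 : 0 < (1 + δ)⁻¹ := by positivity
  have hz1 : (1 + δ)⁻¹ < 1 := inv_lt_one_of_one_lt₀ (by linarith)
  rw [integral_polylogIntegrand_left hX (by linarith), integral_polylogIntegrand_right hb hX h0 h2,
    ← hf, ← hg, ← integral_logKernel_neg hX]
  have i1 : IntervalIntegrable f volume 0 (1 - δ) :=
    intervalIntegrable_logKernel hb _ _ _ (by linarith) (by linarith)
  have i2 : IntervalIntegrable g volume 0 (1 - δ) :=
    intervalIntegrable_logKernel hb _ _ _ (by linarith) (by linarith)
  have i3 : IntervalIntegrable g volume 0 X := intervalIntegrable_logKernel hb _ _ _ hX.le hX1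
  have i4 : IntervalIntegrable g volume 0 (1 + δ)⁻¹ :=
    intervalIntegrable_logKernel hb _ _ _ hz0.le hz1
  rw [intervalIntegral.integral_sub i1 i2, ← intervalIntegral.integral_interval_sub_left i4 i2,
    ← intervalIntegral.integral_interval_sub_left i4 i3]
  ring

theorem tendsto_cutoff {b X : ℝ} (hb : b = 1 ∨ b = -1) (hX : 0 < X) (hX1 : X < 1) (p : ℕ) :
    Tendsto (fun ε : ℝ => (∫ y in (0 : ℝ)..(X - ε), polylogIntegrand p (b * X⁻¹) y) +
      ∫ y in (X + ε)..1, polylogIntegrand p (b * X⁻¹) y) (𝓝[>] 0)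
      (𝓝 (inversionValue p b X)) := by
  have hs : Tendsto (fun ε : ℝ => X⁻¹ * ε) (𝓝[>] 0) (𝓝[>] 0) := by
    refine tendsto_nhdsWithin_iff.2 ⟨?_, ?_⟩
    · have : Tendsto (fun ε : ℝ => X⁻¹ * ε) (𝓝 0) (𝓝 (X⁻¹ * 0)) :=
        Continuous.tendsto (by fun_prop) 0
      rw [mul_zero] at this
      exact this.mono_left nhdsWithin_le_nhds
    · filter_upwards [self_mem_nhdsWithin] with ε hε
      exact mul_pos (inv_pos.2 hX) hε
  refine ((tendsto_cutoff_scaled hb hX hX1 p).comp hs).congr fun ε => ?_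
  simp only [Function.comp_apply, mul_inv_cancel_left₀ hX.ne']

theorem hasPVIntegral_polylogIntegrand {X : ℝ} (hX : 0 < X) (hX1 : X < 1) (p : ℕ) :
    HasPVIntegral (polylogIntegrand p X⁻¹) 0 X 1 (inversionValue p 1 X) := by
  have ht := tendsto_cutoff (Or.inl rfl) hX hX1 p
  have hi := fun z => intervalIntegrable_polylogIntegrand_left (z := z) (Or.inl rfl) hX p
  have hc := continuousOn_polylogIntegrand_right (Or.inl rfl) hX p
  simp only [one_mul] at ht hi hc
  refine ⟨?_, ht⟩
  have hlt : ∀ᶠ ε : ℝ in 𝓝[>] 0, ε < min X (1 - X) :=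
    (eventually_lt_nhds (lt_min hX (by linarith))).filter_mono nhdsWithin_le_nhds
  filter_upwards [hlt, self_mem_nhdsWithin] with ε h1 h2
  have h3 : ε < X := h1.trans_le (min_le_left _ _)
  have h4 : ε < 1 - X := h1.trans_le (min_le_right _ _)
  have h5 : 0 < ε := h2
  refine ⟨hi _ (by linarith) (by linarith) fun _ => by linarith, ?_⟩
  refine (hc.mono fun y hy => ?_).intervalIntegrable
  rw [Set.uIcc_of_le (by linarith)] at hy
  exact lt_of_lt_of_le (by linarith) hy.1

/-- For b = -1 there is no pole at y = X, and the cut-off integrals tend to the ordinary integral.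
One computation thus serves both signs. -/
theorem polylog_mul_inv {b X : ℝ} (hb : b = 1 ∨ b = -1) (hX : 0 < X) (hX1 : X < 1) (p : ℕ) :
    polylog p (b * X⁻¹) =
      (-1) ^ (p - 1) / ((p - 1).factorial : ℝ) * inversionValue p b X := by
  have ht := tendsto_cutoff hb hX hX1 p
  rw [polylog]
  congr 1
  rcases hb with rfl | rfl
  · have : 1 < X⁻¹ := (one_lt_inv₀ hX).2 hX1
    rw [one_mul] at ht ⊢
    rw [if_neg (by linarith), pvIntegral, one_div, inv_inv]
    exact ht.limUnder_eq
  · have : 0 < X⁻¹ := inv_pos.2 hX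
    rw [if_pos (by linarith)]
    refine tendsto_nhds_unique ?_ ht
    have hi : IntervalIntegrable (polylogIntegrand p (-1 * X⁻¹)) volume 0 1 :=
      intervalIntegrable_polylogIntegrand_left (Or.inr rfl) hX p zero_le_one le_rfl
        (fun h => by norm_num at h)
    have hc := intervalIntegral.continuousOn_primitive_interval (a := (0 : ℝ)) (b := 1)
      (f := polylogIntegrand p (-1 * X⁻¹)) (μ := volume) (by
        rw [Set.uIcc_of_le zero_le_one, integrableOn_Icc_iff_integrableOn_Ioc]
        exact (intervalIntegrable_iff_integrableOn_Ioc_of_le zero_le_one).1 hi)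
    rw [Set.uIcc_of_le zero_le_one] at hc
    have hcX := hc.continuousAt (Icc_mem_nhds hX hX1)
    have t1 : Tendsto (fun ε : ℝ => X - ε) (𝓝[>] 0) (𝓝 X) := by
      have : Tendsto (fun ε : ℝ => X - ε) (𝓝 0) (𝓝 (X - 0)) := Continuous.tendsto (by fun_prop) 0
      rw [sub_zero] at this
      exact this.mono_left nhdsWithin_le_nhds
    have t2 : Tendsto (fun ε : ℝ => X + ε) (𝓝[>] 0) (𝓝 X) := by
      have : Tendsto (fun ε : ℝ => X + ε) (𝓝 0) (𝓝 (X + 0)) := Continuous.tendsto (by fun_prop) 0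
      rw [add_zero] at this
      exact this.mono_left nhdsWithin_le_nhds
    have t3 := (hcX.tendsto.comp t1).add ((tendsto_const_nhds (x :=
      ∫ y in (0 : ℝ)..1, polylogIntegrand p (-1 * X⁻¹) y)).sub (hcX.tendsto.comp t2))
    rw [add_sub_cancel] at t3
    refine t3.congr' ?_
    have hlt : ∀ᶠ ε : ℝ in 𝓝[>] 0, ε < min X (1 - X) :=
      (eventually_lt_nhds (lt_min hX (by linarith))).filter_mono nhdsWithin_le_nhds
    filter_upwards [hlt, self_mem_nhdsWithin] with ε h1 h2
    have h4 : ε < 1 - X := h1.trans_le (min_le_right _ _)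
    have h5 : 0 < ε := h2
    have hi2 : IntervalIntegrable (polylogIntegrand p (-1 * X⁻¹)) volume 0 (X + ε) :=
      intervalIntegrable_polylogIntegrand_left (Or.inr rfl) hX p (by linarith) (by linarith)
        (fun h => by norm_num at h)
    simp only [Function.comp_apply]
    rw [intervalIntegral.integral_interval_sub_left hi hi2]

theorem sum_one_add_neg_one_pow_mul (f : ℕ → ℝ) (p : ℕ) :
    ∑ i ∈ Finset.range p, (1 + (-1) ^ (i + 1)) * f (i + 1) =
      2 * ∑ k ∈ Finset.range (p / 2), f (2 * (k + 1)) := by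
  induction p with
  | zero => simp
  | succ p ih =>
    rw [Finset.sum_range_succ, ih]
    rcases Nat.even_or_odd' (p + 1) with ⟨c, hc | hc⟩
    · have h2 : (p + 1) / 2 = p / 2 + 1 := by omega
      have h3 : 2 * (p / 2 + 1) = p + 1 := by omega
      rw [h2, Finset.sum_range_succ, h3, hc, pow_mul]
      norm_num
      ring
    · have h2 : (p + 1) / 2 = p / 2 := by omega
      rw [h2, hc, pow_succ, pow_mul]
      norm_num

theorem mul_lerchPhi_zero_one {b : ℝ} (hb : b = 1 ∨ b = -1) : b * lerchPhi b 0 1 = -(1 / 2) := by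
  rcases hb with rfl | rfl <;> norm_num [lerchPhi]

/-- The inversion formula for the real polylogarithm. -/
theorem polylog_inversion {b X : ℝ} (hb : b = 1 ∨ b = -1) (hX : 0 < X) (hX1 : X < 1) {p : ℕ}
    (hp : 1 ≤ p) :
    polylog p (b * X⁻¹) = (-1) ^ (p - 1) * polylog p (b * X) +
      2 * (-1) ^ p * ∑ k ∈ Finset.range (p / 2 + 1),
        b * lerchPhi b (2 * k) 1 * (Real.log X ^ (p - 2 * k) / ((p - 2 * k).factorial : ℝ)) := by
  obtain ⟨r, rfl⟩ := Nat.exists_eq_add_of_le' hp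
  have hbX : b * X ≤ 1 := by rcases hb with rfl | rfl <;> linarith
  have hs : ((-1 : ℝ) ^ r) * (-1) ^ r = 1 := by rw [← mul_pow]; norm_num
  have hr : (r.factorial : ℝ) ≠ 0 := by positivity
  rw [polylog_mul_inv hb hX hX1, inversionValue, polylog, if_pos hbX, Finset.sum_range_succ' _ ((r + 1) / 2)]
  simp only [Nat.add_sub_cancel, mul_zero, Nat.sub_zero]
  -- Since b Φ(b, 0, 1) = -1/2, the term k = 0 is the isolated power of ln X in `inversionValue`.
  rw [mul_lerchPhi_zero_one hb]
  have hsum : ∑ i ∈ Finset.range (r + 1), (r.choose i : ℝ) * Real.log X ^ (r - i) *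
      (1 - (-1) ^ i) * b * ((-1) ^ i * (i.factorial : ℝ) * lerchPhi b (i + 1) 1) =
      -(r.factorial : ℝ) * ∑ i ∈ Finset.range (r + 1), (1 + (-1) ^ (i + 1)) *
        (b * lerchPhi b (i + 1) 1 *
          (Real.log X ^ (r + 1 - (i + 1)) / ((r + 1 - (i + 1)).factorial : ℝ))) := by
    rw [Finset.mul_sum]
    refine Finset.sum_congr rfl fun i hi => ?_
    rw [Finset.mem_range] at hi
    have hch : (r.choose i : ℝ) * (i.factorial : ℝ) * ((r - i).factorial : ℝ) = r.factorial := by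
      exact_mod_cast Nat.choose_mul_factorial_mul_factorial (by omega : i ≤ r)
    have hri : ((r - i).factorial : ℝ) ≠ 0 := by positivity
    rw [Nat.add_sub_add_right, ← hch, pow_succ]
    have hsi : ((-1 : ℝ) ^ i) * (-1) ^ i = 1 := by rw [← mul_pow]; norm_num
    field_simp
    linear_combination
      (-(r.choose i : ℝ) * Real.log X ^ (r - i) * b * lerchPhi b (i + 1) 1) * hsi
  rw [hsum, sum_one_add_neg_one_pow_mul
    (fun i => b * lerchPhi b i 1 * (Real.log X ^ (r + 1 - i) / ((r + 1 - i).factorial : ℝ)))]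
  rw [Nat.factorial_succ, pow_succ (-1 : ℝ) r]
  push_cast
  field_simp
  ring

/-! ### The closed form -/

/-- The hockey-stick identity; it adds up the corrections for the missing index m = 0. -/
theorem sum_Icc_choose_eq {p q : ℕ} (hp : 1 ≤ p) (hq : 1 ≤ q) :
    ∑ k ∈ Finset.Icc 1 q, ((p + q - k - 1).choose (p - 1) : ℝ) =
      ((p + q - 1).choose (q - 1) : ℝ) := by
  obtain ⟨P, rfl⟩ := Nat.exists_eq_add_of_le' hp
  have h1 : ∀ q : ℕ, ∑ r ∈ Finset.range q, ((P + r).choose P : ℝ) = ((P + q).choose (P + 1) : ℝ) := by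
    intro q
    induction q with
    | zero => simp
    | succ q ih =>
      rw [Finset.sum_range_succ, ih, ← add_assoc, Nat.choose_succ_succ]
      push_cast
      ring
  have h2 := sum_range_sub_eq_sum_Icc (fun r _ => ((P + r).choose P : ℝ)) q
  rw [h1] at h2
  rw [show P + 1 + q - 1 = P + q by omega, ← Nat.choose_symm (show q - 1 ≤ P + q by omega),
    show P + q - (q - 1) = P + 1 by omega, h2]
  refine Finset.sum_congr rfl fun k hk => ?_
  rw [Finset.mem_Icc] at hk
  rw [Nat.add_sub_cancel, show P + 1 + q - k - 1 = P + (q - k) by omega]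

theorem sum_Icc_one_eq_sum_range (f : ℕ → ℝ) (p : ℕ) :
    ∑ i ∈ Finset.Icc 1 p, f i = ∑ i ∈ Finset.range p, f (i + 1) := by
  rw [Finset.range_eq_Ico, Finset.sum_Ico_add' f 0 p 1, zero_add]
  rfl

/-- The sum of products of one zeta or eta value and one value of `Φ(a, ·, 1 / 2)`. -/
noncomputable def evenSum (a b : ℝ) (p q n : ℕ) : ℝ :=
  ∑ k ∈ Finset.range (p / 2 + 1), ((p + q - 2 * k - 1).choose (q - 1) : ℝ) *
    (n : ℝ) ^ (-(2 * k : ℤ)) * lerchPhi b (2 * k) 1 * lerchPhi a (p + q - 2 * k) (1 / 2)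

/-- The double sum of products of values of `Θ` and `Φ`. -/
noncomputable def thetaSum (a b : ℝ) (p q n : ℕ) : ℝ :=
  ∑ j ∈ Finset.Icc 1 n, ∑ k ∈ Finset.Icc 1 q,
    ((p + q - k - 1).choose (p - 1) : ℝ) * a ^ j * (-1) ^ k * lerchTheta b k (2 * j - 1) (2 * n) *
      lerchPhi (a ^ n * b) (p + q - k) ((2 * n - 2 * j + 1) / (2 * n))

/-- Only even i survive the factor 1 + (-1)^i. The corrections for m = 0 add up to exactly the
missing term k = 0, because b Φ(b, 0, 1) = -1/2. -/
theorem sum_residues_eq_evenSum {a b : ℝ} {n p q : ℕ} (hp : 1 ≤ p) (hq : 1 ≤ q)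
    (hb : b = 1 ∨ b = -1) :
    ∑ i ∈ Finset.Icc 1 p,
        (-1) ^ (p - i) * ((p + q - i - 1).choose (q - 1) : ℝ) / (n : ℝ) ^ i *
          ((1 + (-1) ^ i) * (b * lerchPhi b i 1) * lerchPhi a (p + q - i) (1 / 2)) -
      (-1) ^ p * ((∑ k ∈ Finset.Icc 1 q, ((p + q - k - 1).choose (p - 1) : ℝ)) *
        lerchPhi a (p + q) (1 / 2)) = 2 * (-1) ^ p * b * evenSum a b p q n := by
  have h1 : ∀ i ∈ Finset.Icc 1 p,
      (-1) ^ (p - i) * ((p + q - i - 1).choose (q - 1) : ℝ) / (n : ℝ) ^ i *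
          ((1 + (-1) ^ i) * (b * lerchPhi b i 1) * lerchPhi a (p + q - i) (1 / 2)) =
      (-1) ^ p * ((1 + (-1) ^ i) * (((p + q - i - 1).choose (q - 1) : ℝ) * ((n : ℝ) ^ i)⁻¹ *
        (b * lerchPhi b i 1) * lerchPhi a (p + q - i) (1 / 2))) := by
    intro i hi
    rw [Finset.mem_Icc] at hi
    have h2 : (-1 : ℝ) ^ p = (-1) ^ (p - i) * (-1) ^ i := by
      rw [← pow_add, Nat.sub_add_cancel hi.2]
    have h3 : (-1 : ℝ) ^ (p - i) * (1 + (-1) ^ i) = (-1) ^ p * (1 + (-1) ^ i) := by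
      have hs : ((-1 : ℝ) ^ i) * (-1) ^ i = 1 := by rw [← mul_pow]; norm_num
      rw [h2]
      linear_combination (-(-1 : ℝ) ^ (p - i)) * hs
    linear_combination (((p + q - i - 1).choose (q - 1) : ℝ) * ((n : ℝ) ^ i)⁻¹ *
        (b * lerchPhi b i 1) * lerchPhi a (p + q - i) (1 / 2)) * h3
  rw [Finset.sum_congr rfl h1, ← Finset.mul_sum, sum_Icc_one_eq_sum_range,
    sum_one_add_neg_one_pow_mul (fun i => ((p + q - i - 1).choose (q - 1) : ℝ) *
      ((n : ℝ) ^ i)⁻¹ * (b * lerchPhi b i 1) * lerchPhi a (p + q - i) (1 / 2)),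
    sum_Icc_choose_eq hp hq, evenSum, Finset.sum_range_succ']
  have h0 := mul_lerchPhi_zero_one hb
  simp only [Nat.cast_zero, mul_zero, neg_zero, zpow_zero, Nat.sub_zero, mul_one]
  rw [mul_add, Finset.mul_sum, Finset.mul_sum, Finset.mul_sum]
  have h4 : ∑ k ∈ Finset.range (p / 2), 2 * (-1) ^ p * b *
      (((p + q - 2 * (k + 1) - 1).choose (q - 1) : ℝ) * (n : ℝ) ^ (-(2 * ((k + 1 : ℕ) : ℤ))) *
        lerchPhi b (2 * (k + 1)) 1 * lerchPhi a (p + q - 2 * (k + 1)) (1 / 2)) =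
      ∑ k ∈ Finset.range (p / 2), (-1) ^ p * (2 * (((p + q - 2 * (k + 1) - 1).choose (q - 1) : ℝ) *
        ((n : ℝ) ^ (2 * (k + 1)))⁻¹ * (b * lerchPhi b (2 * (k + 1)) 1) *
          lerchPhi a (p + q - 2 * (k + 1)) (1 / 2))) := by
    refine Finset.sum_congr rfl fun k _ => ?_
    have : (n : ℝ) ^ (-(2 * ((k + 1 : ℕ) : ℤ))) = ((n : ℝ) ^ (2 * (k + 1)))⁻¹ := by
      rw [zpow_neg]
      norm_cast
    rw [this]
    ring
  rw [h4]
  linear_combination (-2 * (-1) ^ p * ((p + q - 1).choose (q - 1) : ℝ) *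
    lerchPhi a (p + q) (1 / 2)) * h0

/-- The residues are reversed, j → n - j, and Θ is reflected; the reflection accounts for the
factors b and (-1)^k. -/
theorem sum_theta_eq_thetaSum {a b : ℝ} {n p q : ℕ} (hn : 1 ≤ n) (ha : a = 1 ∨ a = -1)
    (hb : b = 1 ∨ b = -1) :
    (n : ℝ) ^ p * ∑ k ∈ Finset.Icc 1 q, ((p + q - k - 1).choose (p - 1) : ℝ) *
      (1 / (n : ℝ) ^ k * ∑ j ∈ Finset.range n, a ^ j / (n : ℝ) ^ (p + q - k) *
        (lerchTheta b k (2 * j + 1) (2 * n) *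
          lerchPhi (a ^ n * b) (p + q - k) ((2 * j + 1) / (2 * n)))) =
      a ^ n * b / (n : ℝ) ^ q * thetaSum a b p q n := by
  have hn0 : (n : ℝ) ≠ 0 := by positivity
  rw [thetaSum, Finset.sum_comm, Finset.mul_sum, Finset.mul_sum]
  refine Finset.sum_congr rfl fun k hk => ?_
  rw [Finset.mem_Icc] at hk
  have hrefl := sum_range_sub_eq_sum_Icc (fun r _ => a ^ r / (n : ℝ) ^ (p + q - k) *
        (lerchTheta b k (2 * r + 1) (2 * n) *
          lerchPhi (a ^ n * b) (p + q - k) ((2 * r + 1) / (2 * n)))) n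
  rw [hrefl, Finset.mul_sum, Finset.mul_sum, Finset.mul_sum, Finset.mul_sum]
  refine Finset.sum_congr rfl fun j hj => ?_
  rw [Finset.mem_Icc] at hj
  have e1 : (2 * ((n - j : ℕ) : ℝ) + 1) = 2 * n - 2 * j + 1 := by
    rw [Nat.cast_sub hj.2]
    ring
  have e2 : (2 * n - 2 * j + 1 : ℝ) = 2 * n - (2 * j - 1) := by ring
  have e3 : a ^ (n - j) = a ^ n * a ^ j := by
    have : a ^ n = a ^ (n - j) * a ^ j := by rw [← pow_add, Nat.sub_add_cancel hj.2]
    rw [this, mul_assoc, pow_mul_pow_of_sign ha, mul_one]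
  have e4 : lerchTheta b k (2 * n - 2 * j + 1) (2 * n) =
      b * (-1) ^ k * lerchTheta b k (2 * j - 1) (2 * n) := by
    rw [e2, lerchTheta_sub hb (by positivity)]
  have e5 : (n : ℝ) ^ p * (n : ℝ) ^ q = (n : ℝ) ^ k * (n : ℝ) ^ (p + q - k) := by
    rw [← pow_add, ← pow_add]
    congr 1
    omega
  rw [e1, e3, e4]
  generalize lerchPhi (a ^ n * b) (p + q - k) ((2 * n - 2 * j + 1) / (2 * n)) = Φ
  generalize lerchTheta b k (2 * j - 1) (2 * n) = Θ
  field_simp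
  linear_combination (a ^ n * a ^ j * b * ((p + q - k - 1).choose (p - 1) : ℝ) * Θ * Φ) * e5

theorem integral_log_mul_polylog {a b : ℝ} {n p q : ℕ} (hn : 1 ≤ n) (hp : 1 ≤ p) (hq : 1 ≤ q)
    (hb : b = 1 ∨ b = -1) (ha : a = (-1 : ℝ) ^ (p + q - 1))
    (hp1 : a ^ n * b = 1 → p ≠ 1) (hq1 : a = 1 → q ≠ 1) :
    ∫ x in (0 : ℝ)..1, Real.log x ^ (q - 1) * polylog p (b * x ^ (2 * n)) / (1 - a * x ^ 2) =
      -(1 / 2) * a ^ (n - 1) * b * (2 : ℝ) ^ (-(q : ℤ)) * ((q - 1).factorial : ℝ)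
          * (1 - (-1) ^ p) * lerchPhi a q (1 / 2) * lerchPhi (a ^ n * b) p 1
        + a * b * (2 : ℝ) ^ (-(q : ℤ)) * (n : ℝ) ^ p * ((q - 1).factorial : ℝ) * evenSum a b p q n
        + 1 / 2 * a ^ (n - 1) * b * (2 * n : ℝ) ^ (-(q : ℤ)) * ((q - 1).factorial : ℝ)
          * thetaSum a b p q n := by
  have ha' : a = 1 ∨ a = -1 := ha ▸ neg_one_pow_eq_or ℝ _
  have hn0 : (n : ℝ) ≠ 0 := by positivity
  have hsp : ((-1 : ℝ) ^ p) * (-1) ^ p = 1 := by rw [← mul_pow]; norm_num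
  have hsq : ((-1 : ℝ) ^ (q - 1)) * (-1) ^ (q - 1) = 1 := by rw [← mul_pow]; norm_num
  have hapq : a = (-1) ^ p * (-1) ^ (q - 1) := by rw [ha, ← pow_add]; congr 1; omega
  have hpq : a * (-1) ^ (p + q) = -1 := by
    rw [hapq, show p + q = p + (q - 1) + 1 by omega, pow_succ, pow_add]
    linear_combination (-(-1 : ℝ) ^ (q - 1) * (-1) ^ (q - 1)) * hsp - hsq
  obtain ⟨-, S, hS, hI⟩ := integral_log_mul_polylog_eq hn hp hq ha' hb hq1
  have hE := euler_sum_eq hn hp hq ha' hb hpq hp1 hq1 hS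
  simp only [mul_add, Finset.sum_add_distrib, neg_one_mul, mul_neg, Finset.sum_neg_distrib] at hE
  rw [← Finset.sum_mul] at hE
  have hR := sum_residues_eq_evenSum (a := a) (n := n) hp hq hb
  have hTh := sum_theta_eq_thetaSum (p := p) (q := q) hn ha' hb
  have h2S : 2 * S = (1 - (-1) ^ p) * lerchPhi a q (1 / 2) *
        (a ^ n * b * lerchPhi (a ^ n * b) p 1) +
      (n : ℝ) ^ p * (2 * (-1) ^ p * b * evenSum a b p q n) +
      (-1) ^ p * (a ^ n * b / (n : ℝ) ^ q * thetaSum a b p q n) := by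
    linear_combination hE + (n : ℝ) ^ p * hR + (-1) ^ p * hTh
  have han : a ^ n = a * a ^ (n - 1) := by rw [← pow_succ', Nat.sub_add_cancel hn]
  rw [hI, zpow_neg, zpow_neg, zpow_natCast, zpow_natCast, mul_pow]
  have hS2 : S = (2 * S) / 2 := by ring
  rw [hS2, h2S]
  generalize lerchPhi (a ^ n * b) p 1 = Φc
  rw [han]
  generalize a ^ (n - 1) = A
  have haa := sq_eq_one_of_sign ha'
  have c1 : (-1 : ℝ) ^ (q - 1) * (-1) ^ p = a := by rw [hapq]; ring
  have c2 : (-1 : ℝ) ^ (q - 1) = a * (-1) ^ p := by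
    rw [hapq]
    linear_combination (-(-1 : ℝ) ^ (q - 1)) * hsp
  rw [c2]
  field_simp
  ring_nf
  have hsp2 : ((-1 : ℝ) ^ (p * 2)) = 1 := by rw [pow_mul]; exact (sq _).trans hsp
  have haa2 : a ^ 2 = 1 := by rw [sq, haa]
  simp only [hsp2, haa2]
  ring

/-! ### Reciprocal arguments -/

/-- Each power of ln x integrates to a value Φ(a, p + q - 2k, 1/2), and the quotient (p + q - 2k -
1)!/(p - 2k)! is the binomial coefficient times (q - 1)!. -/
theorem intervalIntegrable_and_integral_inversion_terms {a b : ℝ} {n p q : ℕ} (hp : 1 ≤ p)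
    (hq : 1 ≤ q) (hn : 1 ≤ n) (ha : a = (-1 : ℝ) ^ (p + q - 1)) (hq1 : a = 1 → q ≠ 1) :
    IntervalIntegrable (fun x : ℝ => ∑ k ∈ Finset.range (p / 2 + 1),
        (2 * (-1) ^ p * (b * lerchPhi b (2 * k) 1) * (2 * n) ^ (p - 2 * k) /
          ((p - 2 * k).factorial : ℝ)) *
            (Real.log x ^ (p + q - 2 * k - 1) / (1 - a * x ^ 2))) volume 0 1 ∧
      ∫ x in (0 : ℝ)..1, ∑ k ∈ Finset.range (p / 2 + 1),
        (2 * (-1) ^ p * (b * lerchPhi b (2 * k) 1) * (2 * n) ^ (p - 2 * k) /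
          ((p - 2 * k).factorial : ℝ)) *
            (Real.log x ^ (p + q - 2 * k - 1) / (1 - a * x ^ 2)) =
      2 * (-1) ^ p * a * b / 2 ^ q * (n : ℝ) ^ p * ((q - 1).factorial : ℝ) *
        evenSum a b p q n := by
  have ha' : a = 1 ∨ a = -1 := ha ▸ neg_one_pow_eq_or ℝ _
  have har : ∀ k ∈ Finset.range (p / 2 + 1), a = 1 → p + q - 2 * k - 1 ≠ 0 := by
    intro k hk h
    rw [Finset.mem_range] at hk
    have := hq1 h
    omega
  have hi : ∀ k ∈ Finset.range (p / 2 + 1), IntervalIntegrable (fun x : ℝ =>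
      (2 * (-1) ^ p * (b * lerchPhi b (2 * k) 1) * (2 * n) ^ (p - 2 * k) /
          ((p - 2 * k).factorial : ℝ)) *
            (Real.log x ^ (p + q - 2 * k - 1) / (1 - a * x ^ 2))) volume 0 1 := fun k hk =>
    (intervalIntegrable_log_pow_div ha' (har k hk) (by norm_num)).const_mul _
  refine ⟨intervalIntegrable_fun_sum hi, ?_⟩
  rw [intervalIntegral.integral_finsetSum hi, evenSum, Finset.mul_sum]
  refine Finset.sum_congr rfl fun k hk => ?_
  have hint := integral_pow_mul_log_pow_div ha' (har k hk) (d := 2) (by norm_num) 0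
  simp only [pow_zero, one_mul] at hint
  rw [intervalIntegral.integral_const_mul, hint]
  rw [Finset.mem_range] at hk
  obtain ⟨m, rfl⟩ : ∃ m, p = 2 * k + m := ⟨p - 2 * k, by omega⟩
  obtain ⟨Q, rfl⟩ := Nat.exists_eq_add_of_le' hq
  rw [show 2 * k + m + (Q + 1) - 2 * k - 1 = m + Q by omega,
    show 2 * k + m + (Q + 1) - 2 * k = m + Q + 1 by omega, Nat.add_sub_cancel_left,
    Nat.add_sub_cancel]
  rw [show 2 * k + m + (Q + 1) - 1 = 2 * k + (m + Q) by omega, pow_add, pow_mul, neg_one_sq,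
    one_pow, one_mul] at ha
  have hch : ((m + Q).choose Q : ℝ) * (m.factorial : ℝ) * (Q.factorial : ℝ) =
      (m + Q).factorial := by
    have := Nat.add_choose_mul_factorial_mul_factorial m Q
    exact_mod_cast this
  have hz : (n : ℝ) ^ (-(2 * k : ℤ)) = ((n : ℝ) ^ (2 * k))⁻¹ := by
    rw [zpow_neg]
    norm_cast
  have hn0 : (n : ℝ) ≠ 0 := by positivity
  have hm : (m.factorial : ℝ) ≠ 0 := by positivity
  rw [hz, ← ha, ← hch, mul_pow, pow_add (n : ℝ)]
  push_cast
  rw [zero_add]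
  field_simp
  ring

theorem integrand_inversion_eq {a b : ℝ} {n p q : ℕ} (hp : 1 ≤ p) (hq : 1 ≤ q) (hn : 1 ≤ n)
    (hb : b = 1 ∨ b = -1) {x : ℝ} (hx : x ∈ Set.Ioo (0 : ℝ) 1) :
    (-1) ^ (p - 1) * (Real.log x ^ (q - 1) * polylog p (b * x ^ (2 * n)) / (1 - a * x ^ 2)) +
      ∑ k ∈ Finset.range (p / 2 + 1),
        (2 * (-1) ^ p * (b * lerchPhi b (2 * k) 1) * (2 * n) ^ (p - 2 * k) /
          ((p - 2 * k).factorial : ℝ)) *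
            (Real.log x ^ (p + q - 2 * k - 1) / (1 - a * x ^ 2)) =
      Real.log x ^ (q - 1) * polylog p (b * x ^ (-(2 * n : ℤ))) / (1 - a * x ^ 2) := by
  have hX : 0 < x ^ (2 * n) := pow_pos hx.1 _
  have hX1 : x ^ (2 * n) < 1 := pow_lt_one₀ hx.1.le hx.2 (by omega)
  have hz : x ^ (-(2 * n : ℤ)) = (x ^ (2 * n))⁻¹ := by
    rw [zpow_neg]
    norm_cast
  rw [hz, polylog_inversion hb hX hX1 hp, Real.log_pow, mul_add, add_div, Finset.mul_sum,
    Finset.mul_sum, Finset.sum_div]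
  congr 1
  · ring
  · refine Finset.sum_congr rfl fun k hk => ?_
    rw [Finset.mem_range] at hk
    rw [show p + q - 2 * k - 1 = (q - 1) + (p - 2 * k) by omega, pow_add, mul_pow]
    push_cast
    ring

end PolylogIntegral

/-! ### The theorem: both parts assembled -/

open PolylogIntegral in
theorem theorem4 (p q n : ℕ) (hp : 1 ≤ p) (hq : 1 ≤ q) (hn : 1 ≤ n) (a b : ℝ)
    (hb : b = 1 ∨ b = -1) (ha : a = (-1 : ℝ) ^ (p + q - 1))
    (hp1 : a ^ n * b = 1 → p ≠ 1) (hq1 : a = 1 → q ≠ 1) :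
    -- part (i)
    (IntervalIntegrable
        (fun x : ℝ => Real.log x ^ (q - 1) * polylog p (b * x ^ (2 * n)) / (1 - a * x ^ 2))
        MeasureTheory.volume 0 1 ∧
      ∫ x in (0 : ℝ)..1,
          Real.log x ^ (q - 1) * polylog p (b * x ^ (2 * n)) / (1 - a * x ^ 2) =
        -(1 / 2) * a ^ (n - 1) * b * (2 : ℝ) ^ (-(q : ℤ)) * ((q - 1).factorial : ℝ)
            * (1 - (-1) ^ p) * lerchPhi a q (1 / 2) * lerchPhi (a ^ n * b) p 1
          + a * b * (2 : ℝ) ^ (-(q : ℤ)) * (n : ℝ) ^ p * ((q - 1).factorial : ℝ)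
            * ∑ k ∈ Finset.range (p / 2 + 1),
                ((p + q - 2 * k - 1).choose (q - 1) : ℝ) * (n : ℝ) ^ (-(2 * k : ℤ))
                  * lerchPhi b (2 * k) 1 * lerchPhi a (p + q - 2 * k) (1 / 2)
          + 1 / 2 * a ^ (n - 1) * b * (2 * n : ℝ) ^ (-(q : ℤ)) * ((q - 1).factorial : ℝ)
            * ∑ j ∈ Finset.Icc 1 n, ∑ k ∈ Finset.Icc 1 q,
                ((p + q - k - 1).choose (p - 1) : ℝ) * a ^ j * (-1) ^ k
                  * lerchTheta b k (2 * j - 1) (2 * n)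
                  * lerchPhi (a ^ n * b) (p + q - k) ((2 * n - 2 * j + 1) / (2 * n))) ∧
    -- part (ii)
    ((b = 1 → ∀ x ∈ Set.Ioo (0 : ℝ) 1, ∃ v : ℝ,
        HasPVIntegral (polylogIntegrand p (x ^ (-(2 * n : ℤ)))) 0 (x ^ (2 * n)) 1 v) ∧
      IntervalIntegrable
        (fun x : ℝ => Real.log x ^ (q - 1) * polylog p (b * x ^ (-(2 * n : ℤ))) / (1 - a * x ^ 2))
        MeasureTheory.volume 0 1 ∧
      ∫ x in (0 : ℝ)..1,
          Real.log x ^ (q - 1) * polylog p (b * x ^ (-(2 * n : ℤ))) / (1 - a * x ^ 2) =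
        -(1 / 2) * a ^ n * b * (-2 : ℝ) ^ (-(q : ℤ)) * ((q - 1).factorial : ℝ)
            * (1 - (-1) ^ p) * lerchPhi a q (1 / 2) * lerchPhi (a ^ n * b) p 1
          - b * (-2 : ℝ) ^ (-(q : ℤ)) * (n : ℝ) ^ p * ((q - 1).factorial : ℝ)
            * ∑ k ∈ Finset.range (p / 2 + 1),
                ((p + q - 2 * k - 1).choose (q - 1) : ℝ) * (n : ℝ) ^ (-(2 * k : ℤ))
                  * lerchPhi b (2 * k) 1 * lerchPhi a (p + q - 2 * k) (1 / 2)
          + 1 / 2 * a ^ n * b * (-(2 * n) : ℝ) ^ (-(q : ℤ)) * ((q - 1).factorial : ℝ)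
            * ∑ j ∈ Finset.Icc 1 n, ∑ k ∈ Finset.Icc 1 q,
                ((p + q - k - 1).choose (p - 1) : ℝ) * a ^ j * (-1) ^ k
                  * lerchTheta b k (2 * j - 1) (2 * n)
                  * lerchPhi (a ^ n * b) (p + q - k) ((2 * n - 2 * j + 1) / (2 * n))) := by
  have ha' : a = 1 ∨ a = -1 := ha ▸ neg_one_pow_eq_or ℝ _
  have hI1 := (integral_log_mul_polylog_eq hn hp hq ha' hb hq1).1
  have hI := integral_log_mul_polylog hn hp hq hb ha hp1 hq1
  obtain ⟨hJ1, hJ⟩ :=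
    intervalIntegrable_and_integral_inversion_terms (b := b) hp hq hn ha hq1
  have hcongr : ∀ x ∈ Set.Ioo (0 : ℝ) 1, _ = _ := fun x hx =>
    integrand_inversion_eq (a := a) hp hq hn hb hx
  refine ⟨⟨hI1, hI⟩, fun _ x hx => ?_,
    intervalIntegrable_congr_Ioo hcongr ((hI1.const_mul _).add hJ1), ?_⟩
  · have hX : 0 < x ^ (2 * n) := pow_pos hx.1 _
    have hX1 : x ^ (2 * n) < 1 := pow_lt_one₀ hx.1.le hx.2 (by omega)
    have hz : x ^ (-(2 * n : ℤ)) = (x ^ (2 * n))⁻¹ := by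
      rw [zpow_neg]
      norm_cast
    rw [hz]
    exact ⟨_, hasPVIntegral_polylogIntegrand hX hX1 p⟩
  -- The inversion terms are -2 times the `evenSum` term of (-1)^{p-1} times part (i), so that term
  -- alone changes sign; the other signs follow from (-1)^{p-1} a = (-1)^q.
  · rw [← integral_congr_Ioo hcongr, intervalIntegral.integral_add (hI1.const_mul _) hJ1,
      intervalIntegral.integral_const_mul, hI, hJ]
    have hz1 : (-2 : ℝ) ^ (-(q : ℤ)) = (-1) ^ q * (2 : ℝ) ^ (-(q : ℤ)) := by
      rw [neg_eq_neg_one_mul (2 : ℝ), mul_zpow, zpow_neg, zpow_natCast]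
      rcases neg_one_pow_eq_or ℝ q with h | h <;> rw [h] <;> norm_num
    have hz2 : (-(2 * n) : ℝ) ^ (-(q : ℤ)) = (-1) ^ q * (2 * n : ℝ) ^ (-(q : ℤ)) := by
      rw [neg_eq_neg_one_mul (2 * n : ℝ), mul_zpow, zpow_neg, zpow_natCast]
      rcases neg_one_pow_eq_or ℝ q with h | h <;> rw [h] <;> norm_num
    have hz3 : 2 * (-1) ^ p * a * b / 2 ^ q = 2 * (-1) ^ p * a * b * (2 : ℝ) ^ (-(q : ℤ)) := by
      rw [zpow_neg, zpow_natCast, div_eq_mul_inv]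
    rw [← evenSum, ← thetaSum, hz1, hz2, hz3]
    have han : a ^ n = a * a ^ (n - 1) := by rw [← pow_succ', Nat.sub_add_cancel hn]
    generalize lerchPhi (a ^ n * b) p 1 = Φc
    rw [han]
    have hap : (-1) ^ (p - 1) * a = (-1 : ℝ) ^ q := by
      rw [ha, ← pow_add, show p - 1 + (p + q - 1) = 2 * (p - 1) + q by omega, pow_add, pow_mul]
      norm_num
    have hpp : (-1 : ℝ) ^ p = -(-1) ^ (p - 1) := by
      conv_lhs => rw [← Nat.sub_add_cancel hp, pow_succ]
      ring
    generalize evenSum a b p q n = E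
    generalize thetaSum a b p q n = Θ
    rw [hpp]
    generalize (-1 : ℝ) ^ (p - 1) = P at *
    generalize (-1 : ℝ) ^ q = Q at *
    rw [← hap]
    generalize lerchPhi a q (1 / 2) = Φa
    generalize (2 : ℝ) ^ (-(q : ℤ)) = Z
    generalize (2 * n : ℝ) ^ (-(q : ℤ)) = Z'
    generalize a ^ (n - 1) = A
    linear_combination
      (P * A * b * ((q - 1).factorial : ℝ) * (Z * Φa * Φc * (1 + P) - Z' * Θ) / 2) *
        sq_eq_one_of_sign ha'
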